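/- **Setting.** Let $n\ge 1$ and let $H=\sum_{j=0}^{n-1}H_{j,j+1}$ be a nearest-neighbour lattice Hamiltonian: each $H_{j,j+1}$ is a Hermitian operator on a system of qubits that acts only on the sites $j$ and $j+1$ of a chain, which is either open, with sites $0,\dots,n$, or closed, with $n$ sites, $n$ even and site $n$ identified with site $0$. Put $A=\sum_{j\ \mathrm{even}}H_{j,j+1}$, $B=\sum_{j\ \mathrm{odd}}H_{j,j+1}$. Let $\|\cdot\|$ be the spectral norm and let $\|M\|_1=\sum_P|c_P|$ be the $\ell^1$-norm of the coefficients in the expansion $M=\sum_P c_PP$ in Pauli strings. Put $\Lambda=\max_j\|H_{j,j+1}\|$ and $\Lambda_1=\max_j\|H_{j,j+1}\|_1$. Let $K=1$ or $K=2k$ with $k\ge1$. The $K$th-order Trotter formula is $S_1(x)=e^{-ixB}e^{-ixA}$, $S_2(x)=e^{-ixA/2}e^{-ixB}e^{-ixA/2}$ and, for $k\ge2$, $S_{2k}(x)=S_{2k-2}(u_kx)^2\,S_{2k-2}((1-4u_k)x)\,S_{2k-2}(u_kx)^2$ with $u_k=1/(4-4^{1/(2k-1)})$. Let $\kappa$ be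 a stage number of this formula: there are real $a_1,b_1,\dots,a_\kappa,b_\kappa$ such that $S_K(x)=W_\kappa(x)\cdots W_1(x)$, $W_j(x)=e^{-ixb_jB}e^{-ixa_jA}$, holds identically in the operators $A,B$ and in $x$ (for example $\kappa=1$ for $K=1$, and $\kappa=2\cdot5^{k-1}$ for $K=2k$). Put $\beta=2(4\kappa+5)$. Let $U(x)=e^{-ixH}$, $V_K(x)=U(x)S_K(x)^\dagger$, $J_K(x)=S_K(x)\bigl(\tfrac{d}{dx}S_K(x)^\dagger-iHS_K(x)^\dagger\bigr)$ and $C_s=J_K^{(s)}(0)$. For $K+1\le s\le 2K+1$ let $F_s(x)=C_{s-1}x^s/s!$ and $\eta_s=\|C_{s-1}\|_1x^s/s!$; let $\eta_\Sigma=\sum_{s=K+1}^{2K+1}\eta_s$ and $\tilde V_K^{(nc)}(x)=I+\sum_{s=K+1}^{2K+1}F_s(x)$. Write the Pauli expansion of the anti-Hermitian operator $C_s$ as $C_s=i\|C_s\|_1\sum_\gamma\Pr(\gamma|s)P(s,\gamma)$, with $\Pr(\cdot|s)$ a probability distribution (when $C_s\ne0$) and $P(s,\gamma)$ Pauli strings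 with sign $\pm1$. A $(\mu,\varepsilon)$-LCU formula of an operator $V$ consists of $\mu>0$, a finite probability distribution $(p_i)$ and unitaries $V_i$ with $\|V-\mu\sum_ip_iV_i\|\le\varepsilon$. **Proposition.** Let $0<x<\min\{\frac{K+1}{\beta\Lambda},\frac{K+2}{\beta\Lambda_1}\}$ (any $x>0$ if $H_{j,j+1}=0$ for all $j$). Put $\mu_K=\sqrt{1+\eta_\Sigma^2}$ and $\varepsilon_K=\|\tilde V_K^{(nc)}(x)-V_K(x)\|$. Then $$\tilde V_K^{(nc)}(x)=\mu_K\sum_{s=K+1}^{2K+1}\frac{\eta_s}{\eta_\Sigma}\sum_\gamma\Pr(\gamma|s-1)\,e^{\,i\arctan(\eta_\Sigma)P(s-1,\gamma)}$$ (if $\eta_\Sigma=0$, the right-hand side is read as $I$, with the uniform distribution on the indices $(s,\gamma)$), and this is a $(\mu_K,\varepsilon_K)$-LCU formula of $V_K(x)$ with $$\mu_K\le\exp\!\Bigl(\frac{n^2\kappa^2\beta^{2K+2}}{2(K!)^2}(\Lambda_1x)^{2K+2}\Bigr),\qquad \varepsilon_K\le(n\kappa)^2\frac{\beta^{2K+1}}{K!\,(K+1)!}(\Lambda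 x)^{2K+2}.$$ Consequently, multiplying each unitary on the right by $S_K(x)$ gives a $(\mu_K,\varepsilon_K)$-LCU formula $\tilde V_K^{(nc)}(x)S_K(x)$ of $U(x)$. -/

import Mathlib

open scoped Matrix Matrix.Norms.L2Operator

noncomputable section

namespace TrotterLCU

/-! ### Qubits, Pauli strings and the Pauli 1-norm -/

/-- Labels of the computational basis of `N` qubits. -/
abbrev Qubits (N : ℕ) : Type := Fin N → Fin 2

/-- Operators on `N` qubits. The norm on them is the spectral norm
(the instance opened from `Matrix.Norms.L2Operator`). -/
abbrev Op (N : ℕ) : Type := Matrix (Qubits N) (Qubits N) ℂ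

/-- The single-qubit Pauli matrices `I, X, Y, Z`. -/
def pauli : Fin 4 → Matrix (Fin 2) (Fin 2) ℂ :=
  ![!![1, 0; 0, 1], !![0, 1; 1, 0], !![0, -Complex.I; Complex.I, 0], !![1, 0; 0, -1]]

/-- Labels of the `4 ^ N` Pauli strings on `N` qubits. -/
abbrev PauliString (N : ℕ) : Type := Fin N → Fin 4

/-- The `N`-qubit Pauli operator `P₀ ⊗ ⋯ ⊗ P_{N-1}`. -/
def pauliOp {N : ℕ} (p : PauliString N) : Op N :=
  Matrix.of fun s t => ∏ j, pauli (p j) (s j) (t j)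

/-- The coefficient `Tr (P M) / 2 ^ N` of the Pauli operator `P` in the expansion `M = ∑ c_P P`. -/
def pauliCoeff {N : ℕ} (M : Op N) (p : PauliString N) : ℂ :=
  (pauliOp p * M).trace / 2 ^ N

/-- The 1-norm of an operator: the `ℓ¹`-norm of the coefficients of its Pauli expansion. -/
def pauliNorm {N : ℕ} (M : Op N) : ℝ :=
  ∑ p : PauliString N, ‖pauliCoeff M p‖

open Classical in
/-- `M` acts on the set `S` of qubits only, that is `M = T ⊗ 1` with `T` an operator on the
qubits in `S`. -/
def ActsOn {N : ℕ} (S : Set (Fin N)) (M : Op N) : Prop :=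
  ∃ T : Matrix (S → Fin 2) (S → Fin 2) ℂ, ∀ s t : Qubits N,
    M s t = if ∀ v, v ∉ S → s v = t v then T (fun v => s v) (fun v => t v) else 0

/-! ### Lattice Hamiltonians -/

/-- The two sites `j` and `j + 1` of a chain with `N` sites `0, …, N - 1`; the site `N` is `0`. -/
def bond (N j : ℕ) : Set (Fin N) :=
  {v | (v : ℕ) = j ∨ (v : ℕ) = (j + 1) % N}

/-- A nearest-neighbour lattice Hamiltonian `H = ∑_{j < n} H_{j,j+1}` on `N` qubits. The sites form
either an open chain, with the `n + 1` sites `0, …, n`, or a closed chain of `n` sites with `n`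
even, so that in both cases the `H_{j,j+1}` with `j` of one parity act on disjoint pairs. -/
structure LatticeHamiltonian (n N : ℕ) where
  geometry : N = n + 1 ∨ (N = n ∧ Even n)
  term : Fin n → Op N
  isHermitian : ∀ j, (term j).IsHermitian
  actsOn : ∀ j : Fin n, ActsOn (bond N j) (term j)

namespace LatticeHamiltonian

variable {n N : ℕ} (h : LatticeHamiltonian n N)

/-- `A`, the sum of the `H_{j,j+1}` with `j` even. -/
def A : Op N := ∑ j ∈ Finset.univ.filter (fun j : Fin n => Even (j : ℕ)), h.term j

/-- `B`, the sum of the `H_{j,j+1}` with `j` odd. -/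
def B : Op N := ∑ j ∈ Finset.univ.filter (fun j : Fin n => Odd (j : ℕ)), h.term j

/-- The Hamiltonian. -/
def H : Op N := ∑ j : Fin n, h.term j

/-- `Λ`, the largest spectral norm of a summand. -/
def Lam : ℝ := ⨆ j : Fin n, ‖h.term j‖

/-- `Λ₁`, the largest 1-norm of a summand. -/
def Lam1 : ℝ := ⨆ j : Fin n, pauliNorm (h.term j)

end LatticeHamiltonian

/-! ### Time evolution and Trotter formulas -/

section Trotter

variable {m : Type} [Fintype m] [DecidableEq m]

/-- `exp (-i x H)`. -/
def evol (H : Matrix m m ℂ) (x : ℝ) : Matrix m m ℂ :=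
  NormedSpace.exp ((-(Complex.I * (x : ℂ))) • H)

/-- `u_k = 1 / (4 - 4 ^ (1 / (2 k - 1)))`. -/
def suzukiCoeff (k : ℕ) : ℝ := 1 / (4 - (4 : ℝ) ^ (1 / (2 * (k : ℝ) - 1)))

/-- The Trotter formula `S_{2k}(x)` for `H = A + B`:
`S_2(x) = e^{-ixA/2} e^{-ixB} e^{-ixA/2}` and, for `k ≥ 2`,
`S_{2k}(x) = S_{2k-2}(u_k x)² S_{2k-2}((1 - 4 u_k) x) S_{2k-2}(u_k x)²`. -/
def suzuki (A B : Matrix m m ℂ) : ℕ → ℝ → Matrix m m ℂ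
  | 0, _ => 1
  | 1, x => evol A (x / 2) * evol B x * evol A (x / 2)
  | k + 2, x =>
      suzuki A B (k + 1) (suzukiCoeff (k + 2) * x) ^ 2 *
        suzuki A B (k + 1) ((1 - 4 * suzukiCoeff (k + 2)) * x) *
        suzuki A B (k + 1) (suzukiCoeff (k + 2) * x) ^ 2

/-- The `K`th-order Trotter formula `S_K(x)` for `H = A + B`, with `K = 1` or `K` even. -/
def trotter (A B : Matrix m m ℂ) (K : ℕ) (x : ℝ) : Matrix m m ℂ :=
  if K = 1 then evol B x * evol A x else suzuki A B (K / 2) x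

/-- The product `W_κ(x) ⋯ W_2(x) W_1(x)` of the `κ` stages `W_j(x) = e^{-i x b_j B} e^{-i x a_j A}`
(the index `j` runs over `0, …, κ - 1` here). -/
def stageProduct (A B : Matrix m m ℂ) {κ : ℕ} (a b : Fin κ → ℝ) (x : ℝ) : Matrix m m ℂ :=
  (List.ofFn fun j : Fin κ => evol B (b j * x) * evol A (a j * x)).reverse.prod

end Trotter

/-- The stage lengths `a`, `b` write the `K`th-order Trotter formula as a product of `κ` stages,
identically in the two operators and in the time. -/
def IsStageForm (K : ℕ) {κ : ℕ} (a b : Fin κ → ℝ) : Prop :=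
  ∀ (d : ℕ) (A B : Matrix (Fin d) (Fin d) ℂ) (x : ℝ), trotter A B K x = stageProduct A B a b x

/-! ### LCU formulas -/

/-- The probabilities `p` and the unitaries `W` give the `(μ, ε)`-LCU formula `μ ∑ p_i W_i`
of the operator `V`. -/
structure IsLCUFormula {m ι : Type} [Fintype m] [DecidableEq m] [Fintype ι]
    (μ ε : ℝ) (p : ι → ℝ) (W : ι → Matrix m m ℂ) (V : Matrix m m ℂ) : Prop where
  mu_pos : 0 < μ
  prob_nonneg : ∀ i, 0 ≤ p i
  prob_sum : ∑ i, p i = 1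
  unitary : ∀ i, W i ∈ Matrix.unitaryGroup m ℂ
  dist_le : ‖V - (μ : ℂ) • ∑ i, (p i : ℂ) • W i‖ ≤ ε

/-! ### The paired nested-commutator formula -/

namespace LatticeHamiltonian

variable {n N : ℕ} (h : LatticeHamiltonian n N) (K : ℕ)

/-- `S_K(x)`. -/
def S (x : ℝ) : Op N := trotter h.A h.B K x

/-- `U(x) = exp (-i x H)`. -/
def U (x : ℝ) : Op N := evol h.H x

/-- The Trotter remainder `V_K(x) = U(x) S_K(x)†`. -/
def V (x : ℝ) : Op N := h.U x * (h.S K x)ᴴ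

/-- `R_K(x) = d/dx S_K(x)† - i H S_K(x)†`. -/
def R (x : ℝ) : Op N :=
  deriv (fun y : ℝ => (h.S K y)ᴴ) x - Complex.I • (h.H * (h.S K x)ᴴ)

/-- `J_K(x) = S_K(x) R_K(x)`. -/
def J (x : ℝ) : Op N := h.S K x * h.R K x

/-- `C_s = J_K^{(s)}(0)`. -/
def C (s : ℕ) : Op N := iteratedDeriv s (h.J K) 0

/-- `F_{K,s}(x) = C_{s-1} x^s / s!`. -/
def F (s : ℕ) (x : ℝ) : Op N := ((x ^ s / (s.factorial : ℝ) : ℝ) : ℂ) • h.C K (s - 1)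

/-- `Ṽ_K(x) = I + ∑_{s=K+1}^{2K+1} F_{K,s}(x)`. -/
def Vtilde (x : ℝ) : Op N := 1 + ∑ s ∈ Finset.Icc (K + 1) (2 * K + 1), h.F K s x

/-- `η_s = ‖C_{s-1}‖₁ x^s / s!`. -/
def eta (s : ℕ) (x : ℝ) : ℝ := pauliNorm (h.C K (s - 1)) * (x ^ s / (s.factorial : ℝ))

/-- `η_Σ = ∑_{s=K+1}^{2K+1} η_s`. -/
def etaSum (x : ℝ) : ℝ := ∑ s ∈ Finset.Icc (K + 1) (2 * K + 1), h.eta K s x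

/-- `μ_K(x) = √(1 + η_Σ²)`. -/
def mu (x : ℝ) : ℝ := √(1 + h.etaSum K x ^ 2)

/-- `ε_K(x) = ‖Ṽ_K(x) - V_K(x)‖`. -/
def eps (x : ℝ) : ℝ := ‖h.Vtilde K x - h.V K x‖

/-- The real coefficient `r` of `i P` in the Pauli expansion `C_s = i ∑ r_P P` of the
anti-Hermitian operator `C_s`. -/
def coeffC (s : ℕ) (p : PauliString N) : ℝ := (pauliCoeff (h.C K s) p).im

/-- `Pr(γ | s) = |r_γ| / ‖C_s‖₁`. -/
def probC (s : ℕ) (p : PauliString N) : ℝ := |h.coeffC K s p| / pauliNorm (h.C K s)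

/-- The signed Pauli operator `P(s, γ)`, so that `C_s = i ‖C_s‖₁ ∑_γ Pr(γ | s) P(s, γ)`. -/
def signedPauli (s : ℕ) (p : PauliString N) : Op N :=
  if 0 ≤ h.coeffC K s p then pauliOp p else -pauliOp p

/-- The indices `(s, γ)`, with `K + 1 ≤ s ≤ 2K + 1`, of the paired formula. -/
abbrev PairIndex (N K : ℕ) : Type :=
  ↥(Finset.Icc (K + 1) (2 * K + 1)) × PauliString N

/-- The probability `(η_s / η_Σ) Pr(γ | s-1)` of the index `(s, γ)`. If `η_Σ = 0` then all the
unitaries of the formula are `I` and the choice of the distribution is immaterial: take the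
uniform one. -/
def pairedProb (x : ℝ) (i : PairIndex N K) : ℝ :=
  if h.etaSum K x = 0 then 1 / (Fintype.card (PairIndex N K) : ℝ)
  else h.eta K i.1 x / h.etaSum K x * h.probC K (i.1 - 1) i.2

/-- The Pauli rotation `exp (i θ(η_Σ) P(s-1, γ))` with `θ = arctan`. -/
def pairedUnitary (x : ℝ) (i : PairIndex N K) : Op N :=
  NormedSpace.exp ((Complex.I * (Real.arctan (h.etaSum K x) : ℂ)) • h.signedPauli K (i.1 - 1) i.2)

end LatticeHamiltonian

end TrotterLCU

end

/-! Error. In complex time, with the adjoint of S replaced by its inverse, all functions are entire.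
The remainder V = e^{-izH} S⁻¹ solves V' = V J with V(0) = 1. Since S has order K, J = O(z^K) and V
- 1 = O(z^{K+1}), so V' - J = (V - 1) J = O(z^{2K+1}): up to O(z^{2K+2}), V is the integral of the
Taylor polynomial of J of degree 2K, and that is Ṽ. The order (`exists_approxEvol_trotterLayers`) is
Suzuki's argument: the choice of u_k cancels the leading error, and time symmetry excludes leading
errors of even degree.

Size of C_s. Adding a layer E = e^{-iwzA} to S turns J into E (J + iwA) E⁻¹, so the derivatives of J
at 0 are combinations of nested commutators. On a chain, an operator built from a set of bonds
commutes with every term not meeting that set, and one more commutator adds at most one bond to the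
neighbourhood. The counts 3, 4, ..., s + 2 multiply to (s + 2)!/2 (`LocalSum.commutator`,
`LocalGrowth.conj`). With W the total length of the A-layers (and of the B-layers), this gives
ν(C_s) ≤ n (1 + W) Λ (4WΛ)^s (s + 2)!/2 for every submultiplicative seminorm ν with ν(H_{j,j+1}) ≤ Λ
(`seminorm_C_le`), hence for the spectral norm and the Pauli norm alike. Divided by s!, these bounds
sum like a geometric series.

From W to κ. The claim is in terms of an arbitrary stage number κ. For the nilpotent pair A = i e₁₂,
B = i e₂₁ both sides of the stage identity are polynomial in x, and comparing degrees gives κ >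
5^{k-1} (`IsStageForm.five_pow_lt`), while W ≤ (7/3)^{k-1}. What remains is numerical: K = 1 and K =
2 by hand, K ≥ 4 through K! ≤ ((K+1)/2)^K.

Pairing. If P² = 1 and θ = arctan η, then √(1+η²) e^{iθP} = 1 + iηP. Averaging over the signed Pauli
strings of all F_s turns the right side into Ṽ, at the cost √(1+η²) ≤ e^{η²/2} (`mu_smul_sum`). -/

noncomputable section

namespace TrotterLCU

/-! ### Products of exponentials in a Banach algebra, in complex time -/

section Layers

variable {𝒜 : Type*} [NormedRing 𝒜] [NormedAlgebra ℂ 𝒜]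

/-- `exp (-i z A)` for a complex time `z`. -/
def expI (A : 𝒜) (z : ℂ) : 𝒜 := NormedSpace.exp ((-(Complex.I * z)) • A)

/-- The product of the exponentials `exp (-i w z A_b)` over a list of layers `(b, w)`. -/
def layers (op : Bool → 𝒜) : List (Bool × ℝ) → ℂ → 𝒜
  | [], _ => 1
  | p :: l, z => expI (op p.1) (p.2 * z) * layers op l z

/-- The inverse of `layers`. -/
def layersInv (op : Bool → 𝒜) : List (Bool × ℝ) → ℂ → 𝒜
  | [], _ => 1
  | p :: l, z => layersInv op l z * expI (op p.1) (-(p.2 * z))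

/-- The generator `S (d/dz S⁻¹ - i H S⁻¹)` of a product formula `S`. -/
def layersGen (H : 𝒜) (op : Bool → 𝒜) : List (Bool × ℝ) → ℂ → 𝒜
  | [], _ => -(Complex.I • H)
  | p :: l, z => expI (op p.1) (p.2 * z) *
      (layersGen H op l z + (Complex.I * p.2) • op p.1) * expI (op p.1) (-(p.2 * z))

theorem expI_zero (A : 𝒜) : expI A 0 = 1 := by simp [expI]

theorem layers_append (op : Bool → 𝒜) (l l' : List (Bool × ℝ)) (z : ℂ) :
    layers op (l ++ l') z = layers op l z * layers op l' z := by
  induction l with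
  | nil => simp [layers]
  | cons p l ih => rw [List.cons_append, layers, layers, ih, mul_assoc]

theorem layers_scale (op : Bool → 𝒜) (l : List (Bool × ℝ)) (w : ℝ) (z : ℂ) :
    layers op (l.map fun p => (p.1, w * p.2)) z = layers op l (w * z) := by
  induction l with
  | nil => rfl
  | cons p l ih =>
    rw [List.map_cons, layers, layers, ih]; congr 2; push_cast; ring

variable [CompleteSpace 𝒜]

theorem expI_add (A : 𝒜) (z w : ℂ) : expI A (z + w) = expI A z * expI A w := by
  let _ : NormedAlgebra ℚ 𝒜 := NormedAlgebra.restrictScalars ℚ ℂ 𝒜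
  rw [expI, expI, expI, ← NormedSpace.exp_add_of_commute]
  · rw [← add_smul]; congr 2; ring
  · exact ((Commute.refl A).smul_left _).smul_right _

theorem expI_mul_neg (A : 𝒜) (z : ℂ) : expI A z * expI A (-z) = 1 := by
  rw [← expI_add, add_neg_cancel, expI_zero]

theorem expI_neg_mul (A : 𝒜) (z : ℂ) : expI A (-z) * expI A z = 1 := by
  rw [← expI_add, neg_add_cancel, expI_zero]

theorem hasDerivAt_expI (A : 𝒜) (z : ℂ) :
    HasDerivAt (expI A) (expI A z * (-Complex.I • A)) z := by
  have h := hasDerivAt_exp_smul_const (𝕂 := ℂ) (-Complex.I • A) z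
  have e : ∀ z : ℂ, z • (-Complex.I • A) = (-(Complex.I * z)) • A := fun z => by
    rw [smul_smul]; congr 1; ring
  simp only [e] at h
  exact h

theorem hasDerivAt_expI' (A : 𝒜) (z : ℂ) :
    HasDerivAt (expI A) ((-Complex.I • A) * expI A z) z := by
  have h := hasDerivAt_exp_smul_const' (𝕂 := ℂ) (-Complex.I • A) z
  have e : ∀ z : ℂ, z • (-Complex.I • A) = (-(Complex.I * z)) • A := fun z => by
    rw [smul_smul]; congr 1; ring
  simp only [e] at h
  exact h

theorem differentiable_expI (A : 𝒜) : Differentiable ℂ (expI A) :=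
  fun z => (hasDerivAt_expI A z).differentiableAt

@[fun_prop]
theorem differentiable_expI_mul (A : 𝒜) (w : ℂ) : Differentiable ℂ fun z => expI A (w * z) :=
  (differentiable_expI A).comp (differentiable_id.const_mul w)

@[fun_prop]
theorem differentiable_expI_neg_mul (A : 𝒜) (w : ℂ) :
    Differentiable ℂ fun z => expI A (-(w * z)) :=
  (differentiable_expI A).comp (differentiable_id.const_mul w).neg

theorem hasDerivAt_expI_mul (A : 𝒜) (w z : ℂ) :
    HasDerivAt (fun z => expI A (w * z)) (expI A (w * z) * (-(Complex.I * w) • A)) z := by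
  have h := (hasDerivAt_expI A (w * z)).scomp z ((hasDerivAt_id z).const_mul w)
  refine h.congr_deriv ?_
  rw [← mul_smul_comm, smul_smul]; congr 2; simp; ring

theorem hasDerivAt_expI_neg_mul (A : 𝒜) (w z : ℂ) :
    HasDerivAt (fun z => expI A (-(w * z))) (((Complex.I * w) • A) * expI A (-(w * z))) z := by
  have h := (hasDerivAt_expI' A (-(w * z))).scomp z ((hasDerivAt_id z).const_mul w).neg
  refine h.congr_deriv ?_
  rw [← smul_mul_assoc, smul_smul]; congr 2; simp; ring

variable (H : 𝒜) (op : Bool → 𝒜)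

theorem layers_mul_layersInv (l : List (Bool × ℝ)) (z : ℂ) :
    layers op l z * layersInv op l z = 1 := by
  induction l with
  | nil => simp [layers, layersInv]
  | cons p l ih =>
    rw [layers, layersInv, mul_assoc, ← mul_assoc (layers op l z), ih, one_mul, expI_mul_neg]

theorem layersInv_mul_layers (l : List (Bool × ℝ)) (z : ℂ) :
    layersInv op l z * layers op l z = 1 := by
  induction l with
  | nil => simp [layers, layersInv]
  | cons p l ih =>
    rw [layers, layersInv, mul_assoc, ← mul_assoc (expI _ _), expI_neg_mul, one_mul, ih]

theorem differentiable_layers (l : List (Bool × ℝ)) : Differentiable ℂ (layers op l) := by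
  induction l with
  | nil => exact differentiable_const 1
  | cons p l ih => exact (differentiable_expI_mul _ _).mul ih

theorem differentiable_layersInv (l : List (Bool × ℝ)) : Differentiable ℂ (layersInv op l) := by
  induction l with
  | nil => exact differentiable_const 1
  | cons p l ih => exact ih.mul (differentiable_expI_neg_mul _ _)

theorem differentiable_layersGen (l : List (Bool × ℝ)) :
    Differentiable ℂ (layersGen H op l) := by
  induction l with
  | nil => exact differentiable_const _
  | cons p l ih =>
    exact ((differentiable_expI_mul _ _).mul (ih.add_const _)).mul (differentiable_expI_neg_mul _ _)

/-- The defining relation J = S ((S⁻¹)' - iHS⁻¹) of the generator, solved for (S⁻¹)'. Writing S = E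
S' with first layer E, the product rule for S'⁻¹ E⁻¹ produces exactly the recursion of `layersGen`.
-/
theorem hasDerivAt_layersInv (l : List (Bool × ℝ)) (z : ℂ) :
    HasDerivAt (layersInv op l)
      (layersInv op l z * layersGen H op l z + (Complex.I • H) * layersInv op l z) z := by
  induction l with
  | nil =>
    refine (hasDerivAt_const z (1 : 𝒜)).congr_deriv ?_
    simp [layersInv, layersGen]
  | cons p l ih =>
    refine (ih.mul (hasDerivAt_expI_neg_mul (op p.1) p.2 z)).congr_deriv ?_
    have e := expI_neg_mul (op p.1) (p.2 * z)
    rw [layersInv, layersGen]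
    generalize expI (op p.1) (-(p.2 * z)) = E at *
    generalize expI (op p.1) (p.2 * z) = E' at *
    have : layersInv op l z * E * (E' * (layersGen H op l z + (Complex.I * p.2) • op p.1) * E) =
        layersInv op l z * (layersGen H op l z + (Complex.I * p.2) • op p.1) * E := by
      calc _ = layersInv op l z * (E * E') *
            (layersGen H op l z + (Complex.I * p.2) • op p.1) * E := by noncomm_ring
        _ = _ := by rw [e, mul_one]
    rw [this]
    noncomm_ring

/-- The remainder `exp (-i z H) S(z)⁻¹`. -/
def layersRem (l : List (Bool × ℝ)) (z : ℂ) : 𝒜 := expI H z * layersInv op l z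

/-- The equation V' = V J: the terms with H coming from the two factors cancel. -/
theorem hasDerivAt_layersRem (l : List (Bool × ℝ)) (z : ℂ) :
    HasDerivAt (layersRem H op l) (layersRem H op l z * layersGen H op l z) z := by
  refine ((hasDerivAt_expI H z).mul (hasDerivAt_layersInv H op l z)).congr_deriv ?_
  simp only [layersRem, neg_smul, mul_add, neg_mul, mul_neg, mul_assoc]
  abel

end Layers

/-! ### Order conditions -/

section Order

set_option linter.unusedSectionVars false

variable {𝒜 : Type*} [NormedRing 𝒜] [NormedAlgebra ℂ 𝒜] [CompleteSpace 𝒜]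

/-- Division by z: the slope of an entire function at a point is entire, its singularity being
removable. -/
theorem exists_eq_smul_of_apply_zero {f : ℂ → 𝒜} (hf : Differentiable ℂ f) (h0 : f 0 = 0) :
    ∃ g : ℂ → 𝒜, Differentiable ℂ g ∧ g 0 = deriv f 0 ∧ ∀ z, f z = z • g z := by
  refine ⟨dslope f 0, ?_, dslope_same f 0, fun z => ?_⟩
  · rw [← differentiableOn_univ, Complex.differentiableOn_dslope Filter.univ_mem]
    exact hf.differentiableOn
  · have := sub_smul_dslope f 0 z
    rw [h0, sub_zero, sub_zero] at this
    exact this.symm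

/-- `f z = exp (-i α z H) + R z ^ m + O(z ^ (m + 1))`. -/
def ApproxEvol (H : 𝒜) (m : ℕ) (α : ℂ) (R : 𝒜) (f : ℂ → 𝒜) : Prop :=
  ∃ r : ℂ → 𝒜, Differentiable ℂ r ∧ r 0 = R ∧ ∀ z, f z = expI H (α * z) + z ^ m • r z

variable {H : 𝒜}

/-- Leading errors add because the exponentials are 1 at z = 0; the product of the two errors has
degree 2m > m. -/
theorem ApproxEvol.mul {m : ℕ} (hm : m ≠ 0) {α β : ℂ} {R R' : 𝒜} {f g : ℂ → 𝒜}
    (hf : ApproxEvol H m α R f) (hg : ApproxEvol H m β R' g) :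
    ApproxEvol H m (α + β) (R + R') (fun z => f z * g z) := by
  obtain ⟨r, hr, hr0, hfr⟩ := hf
  obtain ⟨s, hs, hs0, hgs⟩ := hg
  refine ⟨fun z => r z * expI H (β * z) + expI H (α * z) * s z + z ^ m • (r z * s z), ?_, ?_, ?_⟩
  · exact ((hr.mul (differentiable_expI_mul H β)).add ((differentiable_expI_mul H α).mul hs)).add
      ((differentiable_id.pow m).smul (hr.mul hs))
  · simp [expI_zero, hr0, hs0, hm]
  · intro z
    simp only
    rw [hfr, hgs, add_mul α, expI_add]
    simp only [mul_add, add_mul, smul_add, smul_mul_assoc, mul_smul_comm]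
    abel

theorem ApproxEvol.comp_mul {m : ℕ} {α : ℂ} {R : 𝒜} {f : ℂ → 𝒜}
    (hf : ApproxEvol H m α R f) (w : ℂ) :
    ApproxEvol H m (α * w) (w ^ m • R) (fun z => f (w * z)) := by
  obtain ⟨r, hr, hr0, hfr⟩ := hf
  refine ⟨fun z => w ^ m • r (w * z), ?_, by simp [hr0], fun z => ?_⟩
  · exact (hr.comp (differentiable_id.const_mul w)).const_smul (w ^ m)
  · simp only
    rw [hfr, smul_smul, mul_pow, mul_comm (z ^ m), mul_assoc]

theorem ApproxEvol.succ {m : ℕ} {α : ℂ} {f : ℂ → 𝒜} (hf : ApproxEvol H m α 0 f) :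
    ∃ R, ApproxEvol H (m + 1) α R f := by
  obtain ⟨r, hr, hr0, hfr⟩ := hf
  obtain ⟨g, hg, -, hrg⟩ := exists_eq_smul_of_apply_zero hr hr0
  refine ⟨g 0, g, hg, rfl, fun z => ?_⟩
  rw [hfr, hrg, smul_smul, pow_succ]

theorem ApproxEvol.residue_unique {m : ℕ} {α : ℂ} {R R' : 𝒜} {f : ℂ → 𝒜}
    (hf : ApproxEvol H m α R f) (hf' : ApproxEvol H m α R' f) : R = R' := by
  obtain ⟨r, hr, rfl, hfr⟩ := hf
  obtain ⟨s, hs, rfl, hfs⟩ := hf'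
  have : Set.EqOn r s {0}ᶜ := fun z hz => by
    have := (hfr z).symm.trans (hfs z)
    rw [add_right_inj] at this
    exact smul_right_injective 𝒜 (pow_ne_zero m hz) this
  exact congrFun (Continuous.ext_on (dense_compl_singleton (0 : ℂ)) hr.continuous hs.continuous
    this) 0

theorem approxEvol_zero (m : ℕ) : ApproxEvol H m 0 0 (fun _ => 1) :=
  ⟨0, differentiable_const 0, rfl, fun z => by simp [expI_zero]⟩

/-- The leading error term of a time-symmetric approximation is of odd degree. -/
theorem ApproxEvol.residue_eq_zero {m : ℕ} (hm : m ≠ 0) (he : Even m) {R : 𝒜} {f : ℂ → 𝒜}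
    (hf : ApproxEvol H m 1 R f) (hs : ∀ z, f z * f (-z) = 1) : R = 0 := by
  -- The product f(z) f(-z) has residue R + (-1)^m R = 2R at total time 0; but it is the constant 1,
  -- whose residue is 0.
  have h := hf.mul hm (hf.comp_mul (-1))
  simp only [he.neg_one_pow, one_smul, mul_neg, mul_one, add_neg_cancel, neg_mul, one_mul, hs] at h
  have := h.residue_unique (approxEvol_zero m)
  rw [← two_smul ℂ R] at this
  exact (smul_eq_zero.1 this).resolve_left two_ne_zero

theorem exists_approxEvol_two {f : ℂ → 𝒜} (hf : Differentiable ℂ f) (h0 : f 0 = 1)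
    (h1 : deriv f 0 = -Complex.I • H) : ∃ R, ApproxEvol H 2 1 R f := by
  have hd : Differentiable ℂ fun z => f z - expI H z := hf.sub (differentiable_expI H)
  obtain ⟨g, hg, hg0, hfg⟩ := exists_eq_smul_of_apply_zero hd (by simp [h0, expI_zero])
  rw [deriv_fun_sub hf.differentiableAt (differentiable_expI H).differentiableAt, h1,
    (hasDerivAt_expI H 0).deriv, expI_zero, one_mul, sub_self] at hg0
  refine ApproxEvol.succ (m := 1) ⟨g, hg, hg0, fun z => ?_⟩
  rw [one_mul, pow_one, ← hfg]; abel

/-! ### Suzuki's formulas -/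

/-- The layers of the Trotter formula of order `2 k`; `true` stands for `A`, `false` for `B`. -/
def suzukiLayers : ℕ → List (Bool × ℝ)
  | 0 => []
  | 1 => [(true, 1 / 2), (false, 1), (true, 1 / 2)]
  | k + 2 =>
    let l := (suzukiLayers (k + 1)).map fun p => (p.1, suzukiCoeff (k + 2) * p.2)
    let l' := (suzukiLayers (k + 1)).map fun p => (p.1, (1 - 4 * suzukiCoeff (k + 2)) * p.2)
    l ++ l ++ l' ++ (l ++ l)

/-- The layers of the Trotter formula of order `K`. -/
def trotterLayers (K : ℕ) : List (Bool × ℝ) :=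
  if K = 1 then [(false, 1), (true, 1)] else suzukiLayers (K / 2)

theorem layers_suzukiLayers_succ (op : Bool → 𝒜) (k : ℕ) (z : ℂ) :
    layers op (suzukiLayers (k + 2)) z =
      layers op (suzukiLayers (k + 1)) (suzukiCoeff (k + 2) * z) *
      layers op (suzukiLayers (k + 1)) (suzukiCoeff (k + 2) * z) *
      layers op (suzukiLayers (k + 1)) ((1 - 4 * suzukiCoeff (k + 2) : ℝ) * z) *
      (layers op (suzukiLayers (k + 1)) (suzukiCoeff (k + 2) * z) *
      layers op (suzukiLayers (k + 1)) (suzukiCoeff (k + 2) * z)) := by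
  rw [suzukiLayers]
  simp only [layers_append, layers_scale]

/-- The list of layers is a palindrome, so the product telescopes from its middle. -/
theorem suzukiLayers_symmetric (op : Bool → 𝒜) (k : ℕ) (z : ℂ) :
    layers op (suzukiLayers k) z * layers op (suzukiLayers k) (-z) = 1 := by
  induction k generalizing z with
  | zero => simp [suzukiLayers, layers]
  | succ k ih =>
    cases k with
    | zero =>
      have e : ∀ (A : 𝒜) (w : ℂ), expI A (w * z) * expI A (w * -z) = 1 := fun A w => by
        rw [mul_neg, expI_mul_neg]
      have a := e (op true) ((1 / 2 : ℝ) : ℂ)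
      have b := e (op false) ((1 : ℝ) : ℂ)
      simp only [suzukiLayers, layers, mul_one]
      generalize expI (op true) (((1 / 2 : ℝ) : ℂ) * z) = x at *
      generalize expI (op true) (((1 / 2 : ℝ) : ℂ) * -z) = x' at *
      generalize expI (op false) (((1 : ℝ) : ℂ) * z) = y at *
      generalize expI (op false) (((1 : ℝ) : ℂ) * -z) = y' at *
      calc x * (y * x) * (x' * (y' * x')) = x * (y * (x * x') * y') * x' := by noncomm_ring
        _ = 1 := by rw [a, mul_one, b, mul_one, a]
    | succ k =>
      rw [layers_suzukiLayers_succ, layers_suzukiLayers_succ]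
      have a := ih (suzukiCoeff (k + 2) * z)
      have b := ih ((1 - 4 * suzukiCoeff (k + 2) : ℝ) * z)
      rw [← mul_neg] at a b
      generalize layers op (suzukiLayers (k + 1)) (suzukiCoeff (k + 2) * z) = x at *
      generalize layers op (suzukiLayers (k + 1)) (suzukiCoeff (k + 2) * -z) = x' at *
      generalize layers op (suzukiLayers (k + 1)) ((1 - 4 * suzukiCoeff (k + 2) : ℝ) * z) = y at *
      generalize layers op (suzukiLayers (k + 1)) ((1 - 4 * suzukiCoeff (k + 2) : ℝ) * -z) = y'
        at *
      calc x * x * y * (x * x) * (x' * x' * y' * (x' * x')) =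
          x * (x * (y * (x * (x * x') * x') * y') * x') * x' := by noncomm_ring
        _ = 1 := by simp only [a, b, mul_one]

/-- With t = 4^{1/(2k+3)} one has u = 1/(4 - t) and 1 - 4u = -tu, and the odd power of -tu is -4
u^{2k+3}. -/
theorem suzukiCoeff_pow (k : ℕ) :
    4 * suzukiCoeff (k + 2) ^ (2 * k + 3) + (1 - 4 * suzukiCoeff (k + 2)) ^ (2 * k + 3) = 0 := by
  set t : ℝ := (4 : ℝ) ^ (1 / (2 * ((k + 2 : ℕ) : ℝ) - 1)) with ht
  have hk : (2 * ((k + 2 : ℕ) : ℝ) - 1) = ((2 * k + 3 : ℕ) : ℝ) := by push_cast; ring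
  have htp : t ^ (2 * k + 3) = 4 := by
    rw [ht, hk, one_div]
    exact Real.rpow_inv_natCast_pow (by norm_num) (by omega)
  have ht4 : t < 4 := by
    by_contra! h
    have h1 : (4 : ℝ) ^ (2 * k + 3) ≤ t ^ (2 * k + 3) := pow_le_pow_left₀ (by norm_num) h _
    have h2 : (4 : ℝ) ^ 2 ≤ 4 ^ (2 * k + 3) := pow_le_pow_right₀ (by norm_num) (by omega)
    linarith
  have hu : suzukiCoeff (k + 2) = 1 / (4 - t) := rfl
  have h4 : (4 - t) ≠ 0 := by linarith
  have : 1 - 4 * suzukiCoeff (k + 2) = -(t * suzukiCoeff (k + 2)) := by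
    rw [hu]; field_simp; ring
  rw [this, Odd.neg_pow ⟨k + 1, by ring⟩, mul_pow, htp]; ring

theorem exists_approxEvol_suzukiLayers (op : Bool → 𝒜) (k : ℕ) :
    ∃ R, ApproxEvol (op true + op false) (2 * k + 3) 1 R (layers op (suzukiLayers (k + 1))) := by
  induction k with
  | zero =>
    obtain ⟨R, hR⟩ : ∃ R, ApproxEvol (op true + op false) 2 1 R (layers op (suzukiLayers 1)) := by
      refine exists_approxEvol_two (differentiable_layers _ _) ?_ ?_
      · simp [suzukiLayers, layers, expI_zero]
      · have := ((hasDerivAt_expI_mul (op true) ((1 / 2 : ℝ) : ℂ) 0).mul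
          ((hasDerivAt_expI_mul (op false) ((1 : ℝ) : ℂ) 0).mul
          ((hasDerivAt_expI_mul (op true) ((1 / 2 : ℝ) : ℂ) 0).mul (hasDerivAt_const 0 (1 : 𝒜)))))
        refine HasDerivAt.deriv (this.congr_deriv ?_)
        simp only [Pi.mul_apply, mul_zero, expI_zero, mul_one, one_mul, add_zero]
        push_cast
        module
    have h0 := hR.residue_eq_zero two_ne_zero even_two (suzukiLayers_symmetric op 1)
    subst h0
    exact hR.succ
  | succ k ih =>
    obtain ⟨R, hR⟩ := ih
    set u := suzukiCoeff (k + 2) with hu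
    have hm : 2 * k + 3 ≠ 0 := by omega
    have a := hR.comp_mul (u : ℂ)
    have b := hR.comp_mul ((1 - 4 * u : ℝ) : ℂ)
    -- Residues of the five factors add with weights u^m (four times) and (1 - 4u)^m, where m = 2k +
    -- 3; the weights sum to zero.
    have c := ((a.mul hm a).mul hm b).mul hm (a.mul hm a)
    simp only [hu, ← layers_suzukiLayers_succ] at c
    rw [← hu] at c
    have e : (1 * (u : ℂ) + 1 * u + 1 * ((1 - 4 * u : ℝ) : ℂ) + (1 * u + 1 * u)) = 1 := by
      push_cast; ring
    have e' : (u : ℂ) ^ (2 * k + 3) • R + (u : ℂ) ^ (2 * k + 3) • R +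
        ((1 - 4 * u : ℝ) : ℂ) ^ (2 * k + 3) • R +
        ((u : ℂ) ^ (2 * k + 3) • R + (u : ℂ) ^ (2 * k + 3) • R) = 0 := by
      have : ((4 * u ^ (2 * k + 3) + (1 - 4 * u) ^ (2 * k + 3) : ℝ) : ℂ) • R = 0 := by
        rw [hu, suzukiCoeff_pow]; simp
      rw [← this]; push_cast; module
    rw [e, e'] at c
    -- The error now starts at the even degree 2k + 4, where symmetry makes it vanish: two orders
    -- are gained at once.
    obtain ⟨R', hR'⟩ := c.succ
    have h0 := hR'.residue_eq_zero (by omega) ⟨k + 2, by ring⟩ (suzukiLayers_symmetric op (k + 2))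
    subst h0
    exact hR'.succ

theorem exists_approxEvol_trotterLayers (op : Bool → 𝒜) {K : ℕ}
    (hK : K = 1 ∨ ∃ k : ℕ, 1 ≤ k ∧ K = 2 * k) :
    ∃ R, ApproxEvol (op true + op false) (K + 1) 1 R (layers op (trotterLayers K)) := by
  rcases hK with rfl | ⟨k, hk, rfl⟩
  · refine exists_approxEvol_two (differentiable_layers _ _) ?_ ?_
    · simp [trotterLayers, layers, expI_zero]
    · have := (hasDerivAt_expI_mul (op false) ((1 : ℝ) : ℂ) 0).mul
          ((hasDerivAt_expI_mul (op true) ((1 : ℝ) : ℂ) 0).mul (hasDerivAt_const 0 (1 : 𝒜)))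
      refine HasDerivAt.deriv (this.congr_deriv ?_)
      simp only [Pi.mul_apply, mul_zero, expI_zero, mul_one, one_mul, add_zero]
      push_cast
      module
  · obtain ⟨k, rfl⟩ := Nat.exists_eq_add_of_le' hk
    rw [trotterLayers, if_neg (by omega), Nat.mul_div_cancel_left _ two_pos]
    exact exists_approxEvol_suzukiLayers op k

/-- The remainder of a formula of order `K` is `1 + O(z ^ (K + 1))`, and its generator is
`O(z ^ K)`. -/
theorem ApproxEvol.layersGen_eq {op : Bool → 𝒜} {l : List (Bool × ℝ)} {K : ℕ} {R : 𝒜}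
    (h : ApproxEvol H (K + 1) 1 R (layers op l)) :
    ∃ g : ℂ → 𝒜, Differentiable ℂ g ∧ ∀ z, layersGen H op l z = z ^ K • g z := by
  obtain ⟨r, hr, -, hS⟩ := h
  set V := layersRem H op l
  -- Substituting e^{-izH} = S - z^{K+1} r into V = e^{-izH} S⁻¹ gives V = 1 + z^{K+1} g.
  set g : ℂ → 𝒜 := fun z => -(r z * layersInv op l z)
  have hg : Differentiable ℂ g := (hr.mul (differentiable_layersInv op l)).neg
  have hV : V = fun z => 1 + z ^ (K + 1) • g z := by
    funext z
    have : expI H z = layers op l z - z ^ (K + 1) • r z := by rw [hS z, one_mul]; abel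
    simp only [V, layersRem, this, sub_mul, layers_mul_layersInv, g, smul_mul_assoc, smul_neg]
    abel
  have hg' : Differentiable ℂ (deriv g) := hg.deriv
  refine ⟨fun z => layers op l z * expI H (-z) *
    (((K + 1 : ℕ) : ℂ) • g z + z • deriv g z), ?_, fun z => ?_⟩
  · have : Differentiable ℂ fun z => expI H (-z) := by
      simpa using differentiable_expI_neg_mul H 1
    have h' : Differentiable ℂ fun z => ((K + 1 : ℕ) : ℂ) • g z + z • deriv g z :=
      (hg.const_smul ((K + 1 : ℕ) : ℂ)).add (differentiable_id.smul hg')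
    exact ((differentiable_layers op l).mul this).mul h'
  · have h1 := hasDerivAt_layersRem H op l z
    have h2 : HasDerivAt V (z ^ (K + 1) • deriv g z + (((K + 1 : ℕ) : ℂ) * z ^ K) • g z) z := by
      rw [hV]
      exact (((hasDerivAt_pow (K + 1) z).smul (hg z).hasDerivAt).const_add 1)
    have h3 := h1.unique h2
    -- The inverse of V is S e^{izH}, so J = V⁻¹ V', and V' = z^K ((K+1) g + z g').
    have h4 : layers op l z * expI H (-z) * layersRem H op l z = 1 := by
      rw [layersRem, mul_assoc, ← mul_assoc (expI H (-z)), expI_neg_mul, one_mul,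
        layers_mul_layersInv]
    rw [← mul_smul_comm, smul_add, smul_smul, smul_smul]
    have h5 := congrArg (fun X => layers op l z * expI H (-z) * X) h3
    rw [← mul_assoc, h4, one_mul] at h5
    rw [h5, add_comm, pow_succ, mul_comm (z ^ K) z, mul_comm (z ^ K) ((K + 1 : ℕ) : ℂ)]

theorem iteratedDeriv_pow_smul_eq_zero {g : ℂ → 𝒜} (hg : Differentiable ℂ g) {s K : ℕ}
    (hs : s < K) : iteratedDeriv s (fun z => z ^ K • g z) 0 = 0 := by
  induction s generalizing K g with
  | zero => simp [(Nat.pos_iff_ne_zero.1 hs)]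
  | succ s ih =>
    obtain ⟨K, rfl⟩ := Nat.exists_eq_succ_of_ne_zero (Nat.ne_of_gt (Nat.zero_lt_of_lt hs))
    rw [iteratedDeriv_succ']
    have : deriv (fun z => z ^ (K + 1) • g z) =
        fun z => z ^ K • (z • deriv g z + ((K + 1 : ℕ) : ℂ) • g z) := by
      funext z
      have := (hasDerivAt_pow (K + 1) z).smul (hg z).hasDerivAt
      refine (this.deriv).trans ?_
      rw [smul_add, smul_smul, smul_smul, pow_succ, mul_comm (z ^ K) ((K + 1 : ℕ) : ℂ)]
      rfl
    rw [Nat.succ_eq_add_one, this]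
    have h' : Differentiable ℂ fun z => z • deriv g z + ((K + 1 : ℕ) : ℂ) • g z :=
      (differentiable_id.smul hg.deriv).add (hg.const_smul ((K + 1 : ℕ) : ℂ))
    exact ih h' (by omega)

end Order

/-! ### Growth of the support under nested commutators -/

/-- A submultiplicative seminorm on a complex algebra. -/
structure IsAlgSeminorm {𝒜 : Type*} [Ring 𝒜] [Algebra ℂ 𝒜] (ν : 𝒜 → ℝ) : Prop where
  add_le : ∀ X Y, ν (X + Y) ≤ ν X + ν Y
  smul : ∀ (c : ℂ) X, ν (c • X) = ‖c‖ * ν X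
  mul_le : ∀ X Y, ν (X * Y) ≤ ν X * ν Y

/-- A family of elements indexed by the vertices of a graph of degree at most two (`nb j` is the
closed neighbourhood of `j`) that commute unless they are neighbours. -/
structure IsChain {𝒜 ι : Type*} [Ring 𝒜] (h : ι → 𝒜) (nb : ι → Finset ι) : Prop where
  self_mem : ∀ j, j ∈ nb j
  symm : ∀ i j, i ∈ nb j → j ∈ nb i
  card_le : ∀ j, (nb j).card ≤ 3
  comm : ∀ i j, i ∉ nb j → Commute (h i) (h j)

section Support

set_option linter.unusedSectionVars false

variable {𝒜 ι : Type*} [Ring 𝒜] [Algebra ℂ 𝒜] [DecidableEq ι]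

/-- `X` is a sum of elements `X_i`, each of which is generated by `h j`, `j ∈ T_i`, where
`T_i` has at most `ℓ + 2` neighbours, and `∑ ν X_i ≤ M`. -/
inductive LocalSum (ν : 𝒜 → ℝ) (h : ι → 𝒜) (nb : ι → Finset ι) (ℓ : ℕ) : 𝒜 → ℝ → Prop
  | single (T : Finset ι) (X : 𝒜) (M : ℝ) : (T.biUnion nb).card ≤ ℓ + 2 →
      X ∈ Algebra.adjoin ℂ (h '' T) → ν X ≤ M → LocalSum ν h nb ℓ X M
  | add (X Y : 𝒜) (M M' : ℝ) : LocalSum ν h nb ℓ X M → LocalSum ν h nb ℓ Y M' →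
      LocalSum ν h nb ℓ (X + Y) (M + M')

theorem IsAlgSeminorm.zero {ν : 𝒜 → ℝ} (hν : IsAlgSeminorm ν) : ν 0 = 0 := by
  simpa using hν.smul 0 0

theorem IsAlgSeminorm.neg {ν : 𝒜 → ℝ} (hν : IsAlgSeminorm ν) (X : 𝒜) : ν (-X) = ν X := by
  simpa using hν.smul (-1) X

theorem IsAlgSeminorm.nonneg {ν : 𝒜 → ℝ} (hν : IsAlgSeminorm ν) (X : 𝒜) : 0 ≤ ν X := by
  have := hν.add_le X (-X)
  rw [add_neg_cancel, hν.zero, hν.neg] at this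
  linarith

variable {ν : 𝒜 → ℝ} {h : ι → 𝒜} {nb : ι → Finset ι} {ℓ : ℕ} {X Y : 𝒜} {M M' : ℝ}

theorem LocalSum.mono (hX : LocalSum ν h nb ℓ X M) (hM : M ≤ M') : LocalSum ν h nb ℓ X M' := by
  induction hX generalizing M' with
  | single T X M hT hX hν => exact .single T X M' hT hX (hν.trans hM)
  | add X Y M₁ M₂ _ _ ih₁ ih₂ =>
    -- All the slack goes to the first summand.
    have := LocalSum.add X Y (M' - M₂) M₂ (ih₁ (by linarith)) (ih₂ le_rfl)
    rwa [sub_add_cancel] at this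

theorem LocalSum.smul (hν : IsAlgSeminorm ν) (hX : LocalSum ν h nb ℓ X M) (c : ℂ) :
    LocalSum ν h nb ℓ (c • X) (‖c‖ * M) := by
  induction hX with
  | single T X M hT hX hM =>
    refine .single T _ _ hT (Subalgebra.smul_mem _ hX c) ?_
    rw [hν.smul]
    exact mul_le_mul_of_nonneg_left hM (norm_nonneg c)
  | add X Y M₁ M₂ _ _ ih₁ ih₂ =>
    rw [smul_add, mul_add]; exact ih₁.add _ _ _ _ ih₂

theorem LocalSum.norm_le (hν : IsAlgSeminorm ν) (hX : LocalSum ν h nb ℓ X M) : ν X ≤ M := by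
  induction hX with
  | single T X M hT hX hM => exact hM
  | add X Y M₁ M₂ _ _ ih₁ ih₂ => exact (hν.add_le _ _).trans (add_le_add ih₁ ih₂)

theorem LocalSum.zero (hν : IsAlgSeminorm ν) : LocalSum ν h nb ℓ 0 0 :=
  .single ∅ 0 0 (by simp) (Subalgebra.zero_mem _) hν.zero.le

theorem LocalSum.sum (hν : IsAlgSeminorm ν) (E : Finset ι) (Z : ι → 𝒜) (f : ι → ℝ)
    (H : ∀ j ∈ E, LocalSum ν h nb ℓ (Z j) (f j)) :
    LocalSum ν h nb ℓ (∑ j ∈ E, Z j) (∑ j ∈ E, f j) := by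
  induction E using Finset.induction_on with
  | empty => simpa using LocalSum.zero hν
  | insert j E hj ih =>
    rw [Finset.sum_insert hj, Finset.sum_insert hj]
    exact .add _ _ _ _ (H j (by simp)) (ih fun i hi => H i (by simp [hi]))

variable {Λ : ℝ}

theorem IsChain.localSum_sum (hc : IsChain h nb) (hν : IsAlgSeminorm ν) (hΛ : ∀ j, ν (h j) ≤ Λ)
    (E : Finset ι) : LocalSum ν h nb 1 (∑ j ∈ E, h j) (E.card * Λ) := by
  have := LocalSum.sum (ℓ := 1) (h := h) (nb := nb) hν E h (fun _ => Λ) fun j _ => by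
    refine .single {j} _ _ (by simpa using hc.card_le j) ?_ (hΛ j)
    exact Algebra.subset_adjoin (by simp)
  simpa using this

/-- A bond j in the neighbourhood of T is adjacent to some t in T. Among the at most three elements
of its own neighbourhood, j and t are already counted, so only one can be new. -/
theorem IsChain.card_biUnion_insert_le (hc : IsChain h nb) {T : Finset ι} {j : ι}
    (hj : j ∈ T.biUnion nb) :
    ((insert j T).biUnion nb).card ≤ (T.biUnion nb).card + 1 := by
  obtain ⟨t, ht, hjt⟩ := Finset.mem_biUnion.1 hj
  rw [Finset.biUnion_insert]
  by_cases hjT : j ∈ T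
  · rw [Finset.union_eq_right.2 (Finset.subset_biUnion_of_mem nb hjT)]; omega
  have hne : j ≠ t := fun e => hjT (e ▸ ht)
  have h1 : nb j ∪ T.biUnion nb ⊆ T.biUnion nb ∪ (nb j \ {j, t}) := by
    intro i hi
    rw [Finset.mem_union] at hi ⊢
    rcases hi with hi | hi
    · by_cases e : i = j
      · subst e; exact .inl hj
      by_cases e' : i = t
      · subst e'; exact .inl (Finset.mem_biUnion.2 ⟨i, ht, hc.self_mem i⟩)
      · exact .inr (by simp [hi, e, e'])
    · exact .inl hi
  have h2 : (nb j \ {j, t}).card ≤ 1 := by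
    have hs : ({j, t} : Finset ι) ⊆ nb j := by
      intro i hi
      rcases Finset.mem_insert.1 hi with rfl | hi
      · exact hc.self_mem _
      · rw [Finset.mem_singleton.1 hi]; exact hc.symm _ _ hjt
    have := hc.card_le j
    rw [Finset.card_sdiff_of_subset hs, Finset.card_pair hne]; omega
  calc _ ≤ _ := Finset.card_le_card h1
    _ ≤ _ := Finset.card_union_le _ _
    _ ≤ _ := by omega

theorem IsChain.commute_of_notMem (hc : IsChain h nb) {T : Finset ι} {j : ι}
    (hj : j ∉ T.biUnion nb) (hX : X ∈ Algebra.adjoin ℂ (h '' T)) : Commute (h j) X := by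
  refine Algebra.commute_of_mem_adjoin_of_forall_mem_commute hX fun b hb => ?_
  obtain ⟨t, ht, rfl⟩ := hb
  exact hc.comm _ _ fun hjt => hj (Finset.mem_biUnion.2 ⟨t, ht, hjt⟩)

/-- On a single local piece only the at most ℓ + 2 terms in its neighbourhood fail to commute. Each
contributes a commutator of size at most 2ΛM, supported on T with one bond added. -/
theorem LocalSum.commutator (hX : LocalSum ν h nb ℓ X M) (hc : IsChain h nb)
    (hν : IsAlgSeminorm ν) (hΛ0 : 0 ≤ Λ) (hΛ : ∀ j, ν (h j) ≤ Λ)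
    (E : Finset ι) :
    LocalSum ν h nb (ℓ + 1) ((∑ j ∈ E, h j) * X - X * ∑ j ∈ E, h j)
      (2 * Λ * (ℓ + 2) * M) := by
  induction hX with
  | single T X M hT hX hM =>
    have e : (∑ j ∈ E, h j) * X - X * ∑ j ∈ E, h j =
        ∑ j ∈ E ∩ T.biUnion nb, (h j * X - X * h j) := by
      rw [Finset.sum_mul, Finset.mul_sum, ← Finset.sum_sub_distrib]
      refine (Finset.sum_subset Finset.inter_subset_left fun j hj hj' => ?_).symm
      rw [sub_eq_zero]
      exact hc.commute_of_notMem (fun h' => hj' (Finset.mem_inter.2 ⟨hj, h'⟩)) hX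
    have h1 : ∀ j ∈ E ∩ T.biUnion nb, LocalSum ν h nb (ℓ + 1) (h j * X - X * h j)
        (2 * Λ * M) := fun j hj => by
      have hj' := (Finset.mem_inter.1 hj).2
      have hX' : X ∈ Algebra.adjoin ℂ (h '' ↑(insert j T)) :=
        Algebra.adjoin_mono (Set.image_mono (by simp)) hX
      have hj'' : h j ∈ Algebra.adjoin ℂ (h '' ↑(insert j T)) :=
        Algebra.subset_adjoin ⟨j, by simp, rfl⟩
      refine .single (insert j T) _ _ ?_
        (Subalgebra.sub_mem _ (Subalgebra.mul_mem _ hj'' hX') (Subalgebra.mul_mem _ hX' hj'')) ?_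
      · have := hc.card_biUnion_insert_le hj'
        omega
      · have hb : ν (h j) * ν X ≤ Λ * M :=
          mul_le_mul (hΛ j) hM (hν.nonneg X) ((hν.nonneg _).trans (hΛ j))
        calc ν (h j * X - X * h j) ≤ ν (h j * X) + ν (X * h j) := by
              rw [sub_eq_add_neg, ← hν.neg (X * h j)]; exact hν.add_le _ _
          _ ≤ ν (h j) * ν X + ν X * ν (h j) := add_le_add (hν.mul_le _ _) (hν.mul_le _ _)
          _ ≤ 2 * Λ * M := by linarith [mul_comm (ν X) (ν (h j))]
    rw [e]
    refine (LocalSum.sum hν _ _ _ h1).mono ?_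
    rw [Finset.sum_const, nsmul_eq_mul]
    have hcard : ((E ∩ T.biUnion nb).card : ℝ) ≤ ℓ + 2 := by
      exact_mod_cast (Finset.card_le_card Finset.inter_subset_right).trans hT
    have hM0 : 0 ≤ 2 * Λ * M := mul_nonneg (by linarith) ((hν.nonneg X).trans hM)
    calc _ ≤ (ℓ + 2 : ℝ) * (2 * Λ * M) := mul_le_mul_of_nonneg_right hcard hM0
      _ = _ := by ring
  | add X Y M₁ M₂ _ _ ih₁ ih₂ =>
    have := ih₁.add _ _ _ _ ih₂
    convert this using 1
    · noncomm_ring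
    · ring

end Support

/-! ### Derivatives of the generator -/

section Growth

variable {𝒜 ι : Type*} [NormedRing 𝒜] [NormedAlgebra ℂ 𝒜] [CompleteSpace 𝒜] [DecidableEq ι]

set_option linter.unusedSectionVars false

theorem differentiable_iteratedDeriv {f : ℂ → 𝒜} (hf : Differentiable ℂ f) (s : ℕ) :
    Differentiable ℂ (iteratedDeriv s f) := by
  induction s with
  | zero => simpa using hf
  | succ s ih => rw [iteratedDeriv_succ]; exact ih.deriv

theorem iteratedDeriv_clm_comp {F : Type*} [NormedAddCommGroup F] [NormedSpace ℂ F]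
    {f : ℂ → 𝒜} (hf : Differentiable ℂ f) (T : 𝒜 →L[ℂ] F) (s : ℕ) :
    iteratedDeriv s (fun z => T (f z)) = fun z => T (iteratedDeriv s f z) := by
  induction s with
  | zero => simp
  | succ s ih =>
    rw [iteratedDeriv_succ, ih, iteratedDeriv_succ]
    funext z
    exact (T.hasFDerivAt.comp_hasDerivAt z
      (differentiable_iteratedDeriv hf s z).hasDerivAt).deriv

theorem iteratedDeriv_add_of_differentiable {f g : ℂ → 𝒜} (hf : Differentiable ℂ f)
    (hg : Differentiable ℂ g) (s : ℕ) :
    iteratedDeriv s (fun z => f z + g z) = fun z => iteratedDeriv s f z + iteratedDeriv s g z := by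
  induction s with
  | zero => simp
  | succ s ih =>
    rw [iteratedDeriv_succ, ih, iteratedDeriv_succ, iteratedDeriv_succ]
    funext z
    exact ((differentiable_iteratedDeriv hf s z).hasDerivAt.add
      (differentiable_iteratedDeriv hg s z).hasDerivAt).deriv

/-- The commutator with `A` as a continuous linear map. -/
def adL (A : 𝒜) : 𝒜 →L[ℂ] 𝒜 :=
  ContinuousLinearMap.mul ℂ 𝒜 A - (ContinuousLinearMap.mul ℂ 𝒜).flip A

theorem adL_apply (A X : 𝒜) : adL A X = A * X - X * A := rfl

/-- The function `Z` with `(e^{-iwzA} f e^{iwzA})^{(s)} = e^{-iwzA} Z e^{iwzA}`. -/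
def twistDeriv (A : 𝒜) (w : ℂ) (f : ℂ → 𝒜) : ℕ → ℂ → 𝒜
  | 0 => f
  | s + 1 => fun z => deriv (twistDeriv A w f s) z + (-(Complex.I * w)) • adL A (twistDeriv A w f s z)

theorem differentiable_twistDeriv (A : 𝒜) (w : ℂ) {f : ℂ → 𝒜} (hf : Differentiable ℂ f) (s : ℕ) :
    Differentiable ℂ (twistDeriv A w f s) := by
  induction s with
  | zero => exact hf
  | succ s ih =>
    exact ih.deriv.add (((adL A).differentiable.comp ih).const_smul (-(Complex.I * w)))

theorem iteratedDeriv_conj (A : 𝒜) (w : ℂ) {f : ℂ → 𝒜} (hf : Differentiable ℂ f) (s : ℕ) :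
    iteratedDeriv s (fun z => expI A (w * z) * f z * expI A (-(w * z))) =
      fun z => expI A (w * z) * twistDeriv A w f s z * expI A (-(w * z)) := by
  induction s with
  | zero => simp [twistDeriv]
  | succ s ih =>
    rw [iteratedDeriv_succ, ih]
    funext z
    refine (((hasDerivAt_expI_mul A w z).mul
      (differentiable_twistDeriv A w hf s z).hasDerivAt).mul
        (hasDerivAt_expI_neg_mul A w z)).deriv.trans ?_
    simp only [twistDeriv, adL_apply]
    simp only [neg_smul, mul_add, add_mul, neg_mul, mul_neg, smul_sub, mul_assoc, mul_sub, sub_mul,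
      smul_mul_assoc, mul_smul_comm, Pi.mul_apply]
    abel

/-- All the derivatives of `f` at `0` are sums of local terms, of total size
`M (2 c Λ) ^ s (s + 2)! / 2`. -/
def LocalGrowth (ν : 𝒜 → ℝ) (h : ι → 𝒜) (nb : ι → Finset ι) (Λ c M : ℝ) (f : ℂ → 𝒜) : Prop :=
  ∀ s, LocalSum ν h nb (s + 1) (iteratedDeriv s f 0)
    (M * (2 * c * Λ) ^ s * ((s + 2).factorial / 2))

variable {ν : 𝒜 → ℝ} {h : ι → 𝒜} {nb : ι → Finset ι} {Λ c M M' : ℝ} {f g : ℂ → 𝒜}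

theorem LocalGrowth.add (hf : LocalGrowth ν h nb Λ c M f) (hg : LocalGrowth ν h nb Λ c M' g)
    (hf' : Differentiable ℂ f) (hg' : Differentiable ℂ g) :
    LocalGrowth ν h nb Λ c (M + M') (fun z => f z + g z) := fun s => by
  rw [iteratedDeriv_add_of_differentiable hf' hg']
  convert (hf s).add _ _ _ _ (hg s) using 1
  ring

theorem localGrowth_const (hν : IsAlgSeminorm ν) (hΛ0 : 0 ≤ Λ) (hc : 0 ≤ c) (hM : 0 ≤ M) {X : 𝒜}
    (hX : LocalSum ν h nb 1 X M) : LocalGrowth ν h nb Λ c M (fun _ => X) := fun s => by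
  rw [iteratedDeriv_const]
  rcases Nat.eq_zero_or_pos s with rfl | hs
  · simpa using hX
  · rw [if_neg (by omega)]
    exact (LocalSum.zero hν).mono (by positivity)

theorem LocalGrowth.conj (hf : LocalGrowth ν h nb Λ c M f) (hf' : Differentiable ℂ f)
    (hc : IsChain h nb) (hν : IsAlgSeminorm ν) (hΛ0 : 0 ≤ Λ) (hΛ : ∀ j, ν (h j) ≤ Λ)
    (E : Finset ι) (w : ℝ) :
    LocalGrowth ν h nb Λ (c + |w|) M
      (fun z => expI (∑ j ∈ E, h j) (w * z) * f z * expI (∑ j ∈ E, h j) (-(w * z))) := by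
  set A := ∑ j ∈ E, h j with hA
  -- Z_{s+1} = Z_s' - iw[A, Z_s] involves plain derivatives of Z_s, so the induction must carry t of
  -- them. The derivative contributes 2cΛ, the commutator 2|w|Λ, each times s + t + 3; the bounds
  -- add up with equality.
  have key : ∀ s t, LocalSum ν h nb (s + t + 1) (iteratedDeriv t (twistDeriv A w f s) 0)
      (M * (2 * (c + |w|) * Λ) ^ s * (2 * c * Λ) ^ t * ((s + t + 2).factorial / 2)) := by
    intro s
    induction s with
    | zero => intro t; simpa [twistDeriv] using hf t
    | succ s ih =>
      intro t
      have hd := differentiable_twistDeriv A (w : ℂ) hf' s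
      have e : twistDeriv A w f (s + 1) = fun z => deriv (twistDeriv A w f s) z +
          ((-(Complex.I * w)) • adL A) (twistDeriv A w f s z) := rfl
      have hd' : Differentiable ℂ fun z => ((-(Complex.I * w)) • adL A) (twistDeriv A w f s z) :=
        ((-(Complex.I * w)) • adL A).differentiable.comp hd
      rw [e, iteratedDeriv_add_of_differentiable hd.deriv hd', ← iteratedDeriv_succ',
        iteratedDeriv_clm_comp hd]
      have h1 := ih (t + 1)
      have h2 := ((ih t).commutator hc hν hΛ0 hΛ E).smul hν (-(Complex.I * w))
      rw [show s + 1 + t + 1 = s + t + 1 + 1 by ring]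
      refine LocalSum.mono (.add _ _ _ _ h1 h2) (le_of_eq ?_)
      rw [show s + (t + 1) + 2 = (s + t + 2) + 1 by ring,
        show s + 1 + t + 2 = (s + t + 2) + 1 by ring,
        Nat.factorial_succ]
      simp only [norm_neg, norm_mul, Complex.norm_I, Complex.norm_real, Real.norm_eq_abs, one_mul]
      push_cast
      ring
  intro s
  rw [iteratedDeriv_conj A w hf']
  simpa [expI_zero] using key s 0

/-- The growth of the generator of a product formula. -/
theorem localGrowth_layersGen (hc : IsChain h nb) (hν : IsAlgSeminorm ν) (hΛ0 : 0 ≤ Λ)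
    (hΛ : ∀ j, ν (h j) ≤ Λ) (E : Bool → Finset ι) (E' : Finset ι) (l : List (Bool × ℝ)) :
    LocalGrowth ν h nb Λ (l.map fun p => |p.2|).sum
      ((E'.card + (l.map fun p => |p.2| * ((E p.1).card : ℝ)).sum) * Λ)
      (layersGen (∑ j ∈ E', h j) (fun b => ∑ j ∈ E b, h j) l) := by
  induction l with
  | nil =>
    have := (hc.localSum_sum hν hΛ E').smul hν (-Complex.I)
    simp only [norm_neg, Complex.norm_I, one_mul, neg_smul] at this
    simpa using! localGrowth_const hν hΛ0 le_rfl (by positivity) this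
  | cons p l ih =>
    have h1 := (hc.localSum_sum hν hΛ (E p.1)).smul hν (Complex.I * p.2)
    simp only [norm_mul, Complex.norm_I, one_mul, Complex.norm_real, Real.norm_eq_abs] at h1
    have h0 : 0 ≤ (l.map fun p => |p.2|).sum :=
      List.sum_nonneg fun x hx => by
        obtain ⟨p, -, rfl⟩ := List.mem_map.1 hx
        exact abs_nonneg _
    have h2 := localGrowth_const hν hΛ0 h0 (by positivity) h1
    have h3 := (ih.add h2 (differentiable_layersGen _ _ _) (differentiable_const _)).conj
      ((differentiable_layersGen _ _ _).add (differentiable_const _)) hc hν hΛ0 hΛ (E p.1) p.2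
    convert h3 using 1
    · simp [add_comm]
    · simp only [List.map_cons, List.sum_cons]; ring
    · rfl

theorem norm_iteratedDeriv_layersGen_le (hc : IsChain h nb) (hν : IsAlgSeminorm ν) (hΛ0 : 0 ≤ Λ)
    (hΛ : ∀ j, ν (h j) ≤ Λ) (E : Bool → Finset ι) (E' : Finset ι) (l : List (Bool × ℝ)) (s : ℕ) :
    ν (iteratedDeriv s (layersGen (∑ j ∈ E', h j) (fun b => ∑ j ∈ E b, h j) l) 0) ≤
      (E'.card + (l.map fun p => |p.2| * ((E p.1).card : ℝ)).sum) * Λ *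
      (2 * (l.map fun p => |p.2|).sum * Λ) ^ s * ((s + 2).factorial / 2) :=
  (localGrowth_layersGen hc hν hΛ0 hΛ E E' l s).norm_le hν

end Growth

/-! ### Weights of the layers -/

/-- The total length of the stages of either kind in Suzuki's formula of order `2 (k + 1)`. -/
def suzukiWeight : ℕ → ℝ
  | 0 => 1
  | k + 1 => (4 * |suzukiCoeff (k + 2)| + |1 - 4 * suzukiCoeff (k + 2)|) * suzukiWeight k

/-- Here u = 1/(4 - t) with 1 < t ≤ 8/5, because (8/5)³ > 4. The value 1/3 is excluded because 1 -
3u occurs as a factor of a leading coefficient in `suzukiLayers_nilp`. -/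
theorem suzukiCoeff_mem (k : ℕ) : 1 / 3 ≤ suzukiCoeff (k + 2) ∧ suzukiCoeff (k + 2) ≤ 5 / 12 ∧
    suzukiCoeff (k + 2) ≠ 1 / 3 := by
  set t : ℝ := (4 : ℝ) ^ (1 / (2 * ((k + 2 : ℕ) : ℝ) - 1)) with ht
  have hk : (2 * ((k + 2 : ℕ) : ℝ) - 1) = ((2 * k + 3 : ℕ) : ℝ) := by push_cast; ring
  have htp : t ^ (2 * k + 3) = 4 := by
    rw [ht, hk, one_div]
    exact Real.rpow_inv_natCast_pow (by norm_num) (by omega)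
  have h1 : 1 ≤ t := Real.one_le_rpow (by norm_num) (by rw [hk]; positivity)
  have h1' : t ≠ 1 := fun h => by rw [h, one_pow] at htp; norm_num at htp
  have h2 : t ≤ 8 / 5 := by
    by_contra! h
    have h3 : (8 / 5 : ℝ) ^ (2 * k + 3) < t ^ (2 * k + 3) :=
      pow_lt_pow_left₀ h (by norm_num) (by omega)
    have h4 : (8 / 5 : ℝ) ^ 3 ≤ (8 / 5) ^ (2 * k + 3) :=
      pow_le_pow_right₀ (by norm_num) (by omega)
    norm_num at h4
    linarith
  have hu : suzukiCoeff (k + 2) = 1 / (4 - t) := rfl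
  rw [hu]
  have h5 : 0 < 4 - t := by linarith
  refine ⟨?_, ?_, ?_⟩
  · rw [div_le_div_iff₀ (by norm_num) h5]; linarith
  · rw [div_le_div_iff₀ h5 (by norm_num)]; linarith
  · intro h
    rw [div_eq_div_iff h5.ne' (by norm_num)] at h
    exact h1' (by linarith)

theorem suzukiWeight_pos (k : ℕ) : 0 < suzukiWeight k := by
  induction k with
  | zero => exact one_pos
  | succ k ih =>
    have := suzukiCoeff_mem k
    exact mul_pos (add_pos_of_pos_of_nonneg (by rw [abs_of_nonneg] <;> linarith) (abs_nonneg _)) ih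

/-- For u between 1/3 and 5/12 the factor 4|u| + |1 - 4u| is 8u - 1 ≤ 7/3. -/
theorem suzukiWeight_le (k : ℕ) : suzukiWeight k ≤ (7 / 3) ^ k := by
  induction k with
  | zero => exact le_rfl
  | succ k ih =>
    obtain ⟨h1, h2, -⟩ := suzukiCoeff_mem k
    rw [suzukiWeight, pow_succ', abs_of_nonneg (by linarith), abs_of_nonpos (by linarith)]
    exact mul_le_mul (by linarith) ih (suzukiWeight_pos k).le (by norm_num)

theorem sum_map_scale (l : List (Bool × ℝ)) (w : ℝ) (m : Bool → ℝ) :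
    ((l.map fun p => (p.1, w * p.2)).map fun p => |p.2| * m p.1).sum =
      |w| * (l.map fun p => |p.2| * m p.1).sum := by
  induction l with
  | nil => simp
  | cons p l ih =>
    simp only [List.map_cons, List.sum_cons, ih, abs_mul]; ring

/-- The weight m serves twice: m = 1 gives the total length of the layers, m = number of bonds of
each parity gives the size of the generator. -/
theorem sum_suzukiLayers (k : ℕ) (m : Bool → ℝ) :
    ((suzukiLayers (k + 1)).map fun p => |p.2| * m p.1).sum =
      suzukiWeight k * (m true + m false) := by
  induction k with
  | zero => norm_num [suzukiLayers, suzukiWeight]; ring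
  | succ k ih =>
    rw [suzukiLayers]
    simp only [List.map_append, List.sum_append, sum_map_scale, ih, suzukiWeight]
    ring

/-- The total length of the stages of either kind in the Trotter formula of order `K`. -/
def trotterWeight (K : ℕ) : ℝ := if K = 1 then 1 else suzukiWeight (K / 2 - 1)

theorem sum_trotterLayers {K : ℕ} (hK : K = 1 ∨ ∃ k : ℕ, 1 ≤ k ∧ K = 2 * k) (m : Bool → ℝ) :
    ((trotterLayers K).map fun p => |p.2| * m p.1).sum =
      trotterWeight K * (m true + m false) := by
  rcases hK with rfl | ⟨k, hk, rfl⟩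
  · norm_num [trotterLayers, trotterWeight]; ring
  · obtain ⟨k, rfl⟩ := Nat.exists_eq_add_of_le' hk
    rw [trotterLayers, trotterWeight, if_neg (by omega), if_neg (by omega),
      Nat.mul_div_cancel_left _ two_pos, sum_suzukiLayers, Nat.add_sub_cancel]

theorem trotterWeight_pos (K : ℕ) : 0 < trotterWeight K := by
  rw [trotterWeight]; split_ifs
  · exact one_pos
  · exact suzukiWeight_pos _

/-! ### Trotter formulas as products of layers -/

section

variable {m : Type} [Fintype m]

theorem complete_matrix : CompleteSpace (Matrix m m ℂ) := FiniteDimensional.complete ℂ _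

variable [DecidableEq m]

theorem evol_eq (A : Matrix m m ℂ) (x : ℝ) : evol A x = expI A (x : ℂ) := rfl

theorem suzuki_eq (op : Bool → Matrix m m ℂ) (k : ℕ) (x : ℝ) :
    suzuki (op true) (op false) k x = layers op (suzukiLayers k) (x : ℂ) := by
  induction k using Nat.strong_induction_on generalizing x with
  | _ k ih =>
    match k with
    | 0 => rfl
    | 1 =>
      simp only [suzuki, suzukiLayers, layers, evol_eq, mul_one, mul_assoc]
      push_cast
      simp only [one_mul, div_eq_inv_mul, mul_one]
    | k + 2 =>
      rw [suzuki, layers_suzukiLayers_succ, ih _ (by omega), ih _ (by omega)]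
      push_cast
      simp only [sq]

theorem trotter_eq (op : Bool → Matrix m m ℂ) (K : ℕ) (x : ℝ) :
    trotter (op true) (op false) K x = layers op (trotterLayers K) (x : ℂ) := by
  rw [trotter, trotterLayers]
  split_ifs
  · simp [layers, evol_eq]
  · exact suzuki_eq op _ x

theorem conjTranspose_expI {A : Matrix m m ℂ} (hA : A.IsHermitian) (x : ℝ) :
    (expI A (x : ℂ))ᴴ = expI A (-(x : ℂ)) := by
  rw [expI, ← Matrix.exp_conjTranspose, Matrix.conjTranspose_smul, hA, expI]
  congr 2
  simp

theorem conjTranspose_layers {op : Bool → Matrix m m ℂ} (h : ∀ b, (op b).IsHermitian)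
    (l : List (Bool × ℝ)) (x : ℝ) : (layers op l (x : ℂ))ᴴ = layersInv op l (x : ℂ) := by
  induction l with
  | nil => simp [layers, layersInv]
  | cons p l ih =>
    rw [layers, layersInv, Matrix.conjTranspose_mul, ih, ← Complex.ofReal_mul,
      conjTranspose_expI (h _)]

/-- At real times -iH and iwA are anti-Hermitian, and conjugation by the unitary layers preserves
this. -/
theorem conjTranspose_layersGen {H : Matrix m m ℂ} (hH : H.IsHermitian) {op : Bool → Matrix m m ℂ}
    (h : ∀ b, (op b).IsHermitian) (l : List (Bool × ℝ)) (x : ℝ) :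
    (layersGen H op l (x : ℂ))ᴴ = -layersGen H op l (x : ℂ) := by
  induction l with
  | nil => simp [layersGen, Matrix.conjTranspose_smul, hH.eq]
  | cons p l ih =>
    have e : (expI (op p.1) (-(p.2 * x : ℂ)))ᴴ = expI (op p.1) (p.2 * x : ℂ) := by
      rw [← Complex.ofReal_mul, ← conjTranspose_expI (h _), Matrix.conjTranspose_conjTranspose]
    have e' : (expI (op p.1) (p.2 * x : ℂ))ᴴ = expI (op p.1) (-(p.2 * x : ℂ)) := by
      rw [← Complex.ofReal_mul, conjTranspose_expI (h _)]
    rw [layersGen, Matrix.conjTranspose_mul, Matrix.conjTranspose_mul, e, e',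
      Matrix.conjTranspose_add, ih, Matrix.conjTranspose_smul, (h _).eq]
    have : star (Complex.I * (p.2 : ℂ)) = -(Complex.I * p.2) := by simp
    rw [this, neg_smul, ← neg_add, neg_mul, mul_neg, mul_assoc]

end

/-! ### The least number of stages -/

section Stages

open Filter Topology

/-- `f x = x ^ e X + o(x ^ e)` for large `|x|`. -/
def HasLeading (e : ℕ) (f : ℝ → Matrix (Fin 2) (Fin 2) ℂ) (X : Matrix (Fin 2) (Fin 2) ℂ) : Prop :=
  Tendsto (fun x : ℝ => ((x : ℂ) ^ e)⁻¹ • f x) (Bornology.cobounded ℝ) (𝓝 X)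

variable {e e' : ℕ} {f g : ℝ → Matrix (Fin 2) (Fin 2) ℂ} {X Y : Matrix (Fin 2) (Fin 2) ℂ}

theorem HasLeading.mul (hf : HasLeading e f X) (hg : HasLeading e' g Y) :
    HasLeading (e + e') (fun x => f x * g x) (X * Y) := by
  refine (Tendsto.mul hf hg).congr fun x => ?_
  rw [smul_mul_smul_comm, pow_add, mul_inv]

theorem tendsto_ofReal_inv_cobounded :
    Tendsto (fun x : ℝ => ((x : ℂ))⁻¹) (Bornology.cobounded ℝ) (𝓝 0) := by
  have := (Complex.continuous_ofReal.tendsto 0).comp (tendsto_inv₀_cobounded (α := ℝ))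
  simpa [Function.comp_def] using this

theorem HasLeading.comp_mul (hf : HasLeading e f X) {w : ℝ} (hw : w ≠ 0) :
    HasLeading e (fun x => f (w * x)) ((w : ℂ) ^ e • X) := by
  have h := (hf.comp (tendsto_mul_left_cobounded hw)).const_smul ((w : ℂ) ^ e)
  refine h.congr fun x => ?_
  have hw' : (w : ℂ) ≠ 0 := by exact_mod_cast hw
  simp only [Function.comp_apply, smul_smul]
  congr 1
  push_cast
  rw [mul_pow, mul_inv, ← mul_assoc, mul_inv_cancel₀ (pow_ne_zero _ hw'), one_mul]

/-- A function of exact growth x^e cannot be O(x^{e'}) with e' < e. This compares degrees in x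
without introducing polynomials. -/
theorem HasLeading.le (hf : HasLeading e f X) (hX : X ≠ 0) (hg : HasLeading e' f Y) : e ≤ e' := by
  by_contra! h
  obtain ⟨d, rfl⟩ := Nat.exists_eq_add_of_lt h
  have h0 : Tendsto (fun x : ℝ => ((x : ℂ))⁻¹ ^ (d + 1) • (((x : ℂ) ^ e')⁻¹ • f x))
      (Bornology.cobounded ℝ) (𝓝 ((0 : ℂ) ^ (d + 1) • Y)) :=
    (tendsto_ofReal_inv_cobounded.pow _).smul hg
  rw [zero_pow (by omega), zero_smul] at h0
  refine hX (tendsto_nhds_unique hf (h0.congr fun x => ?_))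
  rw [smul_smul, inv_pow, ← mul_inv, ← pow_add]
  congr 3; ring

theorem hasLeading_list_prod (e : ℕ) (L : List (ℝ → Matrix (Fin 2) (Fin 2) ℂ))
    (h : ∀ f ∈ L, ∃ X, HasLeading e f X) :
    ∃ X, HasLeading (e * L.length) (fun x => (L.map fun f => f x).prod) X := by
  induction L with
  | nil => exact ⟨1, by simp [HasLeading]⟩
  | cons f L ih =>
    obtain ⟨X, hX⟩ := h f (by simp)
    obtain ⟨Y, hY⟩ := ih fun g hg => h g (by simp [hg])
    refine ⟨X * Y, ?_⟩
    have := hX.mul hY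
    simpa [mul_add, add_comm] using this

/-- The nilpotent matrices `e₁₂` (for `true`) and `e₂₁` (for `false`). -/
def nilp : Bool → Matrix (Fin 2) (Fin 2) ℂ
  | true => !![0, 1; 0, 0]
  | false => !![0, 0; 1, 0]

theorem nilp_mul_self (b : Bool) : nilp b * nilp b = 0 := by
  cases b <;> ext i j <;> fin_cases i <;> fin_cases j <;> simp [nilp, Matrix.mul_apply]

theorem nilp_mul_mul (b : Bool) : nilp b * nilp (!b) * nilp b = nilp b := by
  cases b <;> ext i j <;> fin_cases i <;> fin_cases j <;> simp [nilp, Matrix.mul_apply]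

theorem nilp_ne_zero (b : Bool) : nilp b ≠ 0 := by
  cases b
  · exact fun h => by simpa [nilp] using congrFun (congrFun h 1) 0
  · exact fun h => by simpa [nilp] using congrFun (congrFun h 0) 1

/-- The exponential series stops after the linear term, since the matrix squares to zero. -/
theorem expI_nilp (b : Bool) (z : ℂ) : expI (Complex.I • nilp b) z = 1 + z • nilp b := by
  have h1 : (-(Complex.I * z)) • (Complex.I • nilp b) = z • nilp b := by
    rw [smul_smul]; congr 1; linear_combination (-z) * Complex.I_mul_I
  rw [expI, h1, NormedSpace.exp_eq_tsum ℂ]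
  simp only
  rw [tsum_eq_sum (s := Finset.range 2)]
  · simp [Finset.sum_range_succ]
  · intro k hk
    obtain ⟨k, rfl⟩ := Nat.exists_eq_add_of_le' (not_lt.1 (Finset.mem_range.not.1 hk))
    rw [pow_add, sq, smul_mul_smul_comm, nilp_mul_self, smul_zero, mul_zero, smul_zero]

theorem hasLeading_expI_nilp (b : Bool) (w : ℝ) :
    HasLeading 1 (fun x => expI (Complex.I • nilp b) ((w * x : ℝ) : ℂ)) ((w : ℂ) • nilp b) := by
  have h := (tendsto_ofReal_inv_cobounded.smul_const (1 : Matrix (Fin 2) (Fin 2) ℂ)).add_const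
    ((w : ℂ) • nilp b)
  rw [zero_smul, zero_add] at h
  refine h.congr' ?_
  filter_upwards [(Bornology.eventually_ne_cobounded (0 : ℝ))] with x hx
  have hx' : (x : ℂ) ≠ 0 := by exact_mod_cast hx
  rw [expI_nilp, smul_add, pow_one, smul_smul]
  congr 2
  push_cast
  field_simp

/-- The pair `A = i e₁₂`, `B = i e₂₁`. -/
def nilpOp (b : Bool) : Matrix (Fin 2) (Fin 2) ℂ := Complex.I • nilp b

/-- After adjacent A-layers are merged, the formula alternates between A and B and has 2·5^k + 1
layers. The two outer A-layers are kept apart from P so that copies can be merged in the recursion.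
Alternating products of e₁₂ and e₂₁ do not vanish, so the leading coefficient is nonzero as soon as
all merged lengths are. -/
theorem suzukiLayers_nilp (k : ℕ) : ∃ (P : ℝ → Matrix (Fin 2) (Fin 2) ℂ) (α : ℝ) (c : ℂ),
    α ≠ 0 ∧ c ≠ 0 ∧
    (∀ x : ℝ, layers nilpOp (suzukiLayers (k + 1)) (x : ℂ) =
      expI (nilpOp true) ((α * x : ℝ) : ℂ) * P x * expI (nilpOp true) ((α * x : ℝ) : ℂ)) ∧
    HasLeading (2 * 5 ^ k - 1) P (c • nilp false) := by
  induction k with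
  | zero =>
    refine ⟨fun x => expI (nilpOp false) ((1 * x : ℝ) : ℂ), 1 / 2, 1, by norm_num, one_ne_zero,
      fun x => ?_, ?_⟩
    · simp only [suzukiLayers, layers, mul_one, mul_assoc]
      push_cast
      rfl
    · rw [one_smul]
      have := hasLeading_expI_nilp false 1
      rw [Complex.ofReal_one, one_smul] at this
      exact this
  | succ k ih =>
    obtain ⟨P, α, c, hα, hc, hP, hl⟩ := ih
    obtain ⟨h1, h2, h3⟩ := suzukiCoeff_mem k
    set u := suzukiCoeff (k + 2) with hu
    have hu0 : u ≠ 0 := by intro h; rw [h] at h1; norm_num at h1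
    have hv0 : 1 - 4 * u ≠ 0 := by intro h; linarith
    have hw0 : 1 - 3 * u ≠ 0 := by intro h; exact h3 (by linarith)
    set N : ℝ → ℝ → Matrix (Fin 2) (Fin 2) ℂ := fun a x => expI (nilpOp true) ((a * x : ℝ) : ℂ)
      with hN
    have hNN : ∀ a b x, N a x * N b x = N (a + b) x := fun a b x => by
      let _ := complete_matrix (m := Fin 2)
      simp only [hN]
      rw [← expI_add]; congr 1; push_cast; ring
    have hNw : ∀ w x, expI (nilpOp true) ((α * (w * x) : ℝ) : ℂ) = N (α * w) x := fun w x => by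
      simp only [hN]; congr 2; ring
    -- Five copies of P separated by four merged A-layers: the degree is 5(2·5^k - 1) + 4 =
    -- 2·5^{k+1} - 1. The merged lengths are 2αu and α(1 - 3u), both nonzero.
    let Q : ℝ → Matrix (Fin 2) (Fin 2) ℂ := fun x => P (u * x) * N (α * u + α * u) x * P (u * x) *
      N (α * u + α * (1 - 4 * u)) x * P ((1 - 4 * u) * x) * N (α * (1 - 4 * u) + α * u) x *
      P (u * x) * N (α * u + α * u) x * P (u * x)
    have hlN : ∀ a, HasLeading 1 (N a) ((a : ℂ) • nilp true) := hasLeading_expI_nilp true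
    have hlu := hl.comp_mul hu0
    have hlv := hl.comp_mul hv0
    refine ⟨Q, α * u,
      ((u : ℂ) ^ (2 * 5 ^ k - 1)) ^ 4 * ((1 - 4 * u : ℝ) : ℂ) ^ (2 * 5 ^ k - 1) * c ^ 5 *
      ((α * u + α * u : ℝ) : ℂ) ^ 2 * ((α * u + α * (1 - 4 * u) : ℝ) : ℂ) ^ 2,
      mul_ne_zero hα hu0, ?_, fun x => ?_, ?_⟩
    · have a1 : (u : ℂ) ≠ 0 := by exact_mod_cast hu0
      have a2 : ((1 - 4 * u : ℝ) : ℂ) ≠ 0 := by exact_mod_cast hv0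
      have a3 : ((α * u + α * u : ℝ) : ℂ) ≠ 0 := by
        have : α * u + α * u ≠ 0 := by rw [← two_mul]; positivity
        exact_mod_cast this
      have a4 : ((α * u + α * (1 - 4 * u) : ℝ) : ℂ) ≠ 0 := by
        have : α * u + α * (1 - 4 * u) ≠ 0 := by
          rw [← mul_add]; refine mul_ne_zero hα ?_
          intro h; exact hw0 (by linarith)
        exact_mod_cast this
      exact mul_ne_zero (mul_ne_zero (mul_ne_zero (mul_ne_zero (pow_ne_zero _ (pow_ne_zero _ a1))
        (pow_ne_zero _ a2)) (pow_ne_zero _ hc)) (pow_ne_zero _ a3)) (pow_ne_zero _ a4)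
    · have hPu := hP (u * x)
      have hPv := hP ((1 - 4 * u) * x)
      rw [hNw] at hPu hPv
      rw [Complex.ofReal_mul] at hPu hPv
      rw [layers_suzukiLayers_succ, ← hu, hPu, hPv]
      have e : expI (nilpOp true) ((α * u * x : ℝ) : ℂ) = N (α * u) x := rfl
      rw [e]
      simp only [Q, ← hNN, mul_assoc]
    · have h5 := (((((((hlu.mul (hlN (α * u + α * u))).mul hlu).mul
        (hlN (α * u + α * (1 - 4 * u)))).mul hlv).mul (hlN (α * (1 - 4 * u) + α * u))).mul
          hlu).mul (hlN (α * u + α * u))).mul hlu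
      have hpos : 1 ≤ 5 ^ k := Nat.one_le_pow _ _ (by norm_num)
      convert h5 using 1
      · rw [pow_succ]; omega
      · rw [add_comm (α * (1 - 4 * u))]
        have e := nilp_mul_mul false
        simp only [Bool.not_false] at e
        simp only [smul_smul, smul_mul_smul_comm, e]
        congr 1
        ring

theorem hasLeading_stageProduct {κ : ℕ} (a b : Fin κ → ℝ) :
    ∃ X, HasLeading (2 * κ) (stageProduct (nilpOp true) (nilpOp false) a b) X := by
  have := hasLeading_list_prod 2 (List.ofFn fun j : Fin κ => fun x : ℝ =>
    evol (nilpOp false) (b j * x) * evol (nilpOp true) (a j * x)).reverse ?_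
  · obtain ⟨X, hX⟩ := this
    refine ⟨X, ?_⟩
    rw [List.length_reverse, List.length_ofFn] at hX
    convert hX using 2 with x
    rw [stageProduct, List.map_reverse, List.map_ofFn]
    rfl
  · intro f hf
    rw [List.mem_reverse, List.mem_ofFn] at hf
    obtain ⟨j, rfl⟩ := hf
    have h := (hasLeading_expI_nilp false (b j)).mul (hasLeading_expI_nilp true (a j))
    simp only [evol_eq, nilpOp]
    exact ⟨_, h⟩

theorem IsStageForm.one_le {κ : ℕ} {a b : Fin κ → ℝ} (h : IsStageForm 1 a b) : 1 ≤ κ := by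
  obtain ⟨X, hX⟩ := hasLeading_stageProduct a b
  have h1 := (hasLeading_expI_nilp false 1).mul (hasLeading_expI_nilp true 1)
  have e : stageProduct (nilpOp true) (nilpOp false) a b = fun x : ℝ =>
      expI (Complex.I • nilp false) ((1 * x : ℝ) : ℂ) *
        expI (Complex.I • nilp true) ((1 * x : ℝ) : ℂ) := by
    funext x
    rw [← h 2, trotter, if_pos rfl, one_mul]
    rfl
  rw [e] at hX
  have := h1.le (fun h0 => ?_) hX
  · omega
  · have h2 := congrArg (fun Y => Y * nilp false) h0
    have e := nilp_mul_mul false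
    simp only [Bool.not_false] at e
    simp only [Complex.ofReal_one, one_smul, zero_mul, e] at h2
    exact nilp_ne_zero _ h2

/-- On the nilpotent pair the formula has exact degree 2·5^k + 1, while κ stages reach degree at
most 2κ. -/
theorem IsStageForm.five_pow_lt {κ k : ℕ} {a b : Fin κ → ℝ} (h : IsStageForm (2 * (k + 1)) a b) :
    5 ^ k < κ := by
  obtain ⟨X, hX⟩ := hasLeading_stageProduct a b
  obtain ⟨P, α, c, hα, hc, hP, hl⟩ := suzukiLayers_nilp k
  have h1 := ((hasLeading_expI_nilp true α).mul hl).mul (hasLeading_expI_nilp true α)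
  have e : stageProduct (nilpOp true) (nilpOp false) a b = fun x : ℝ =>
      expI (Complex.I • nilp true) ((α * x : ℝ) : ℂ) * P x *
        expI (Complex.I • nilp true) ((α * x : ℝ) : ℂ) := by
    funext x
    rw [← h 2, trotter_eq, trotterLayers, if_neg (by omega), Nat.mul_div_cancel_left _ two_pos, hP]
    rfl
  rw [e] at hX
  have := h1.le (fun h0 => ?_) hX
  · have hpos : 1 ≤ 5 ^ k := Nat.one_le_pow _ _ (by norm_num)
    omega
  · have e := nilp_mul_mul true
    simp only [Bool.not_true] at e
    have hα' : (α : ℂ) ≠ 0 := by exact_mod_cast hα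
    simp only [smul_mul_smul_comm, e] at h0
    exact smul_ne_zero (mul_ne_zero (mul_ne_zero hα' hc) hα') (nilp_ne_zero _) h0

end Stages

/-! ### Pauli strings -/

section Pauli

variable {N : ℕ}

theorem conjTranspose_pauli (p : Fin 4) : (pauli p)ᴴ = pauli p := by
  fin_cases p <;> ext i j <;> fin_cases i <;> fin_cases j <;>
    simp [pauli, Matrix.conjTranspose_apply]

/-- The phase in the product of two Pauli matrices. -/
def pauliPhase : Fin 4 → Fin 4 → ℂ :=
  ![![1, 1, 1, 1], ![1, 1, Complex.I, -Complex.I], ![1, -Complex.I, 1, Complex.I],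
    ![1, Complex.I, -Complex.I, 1]]

/-- The label of the product of two Pauli matrices. -/
def pauliProd : Fin 4 → Fin 4 → Fin 4 :=
  ![![0, 1, 2, 3], ![1, 0, 3, 2], ![2, 3, 0, 1], ![3, 2, 1, 0]]

theorem norm_pauliPhase (p q : Fin 4) : ‖pauliPhase p q‖ = 1 := by
  fin_cases p <;> fin_cases q <;> simp [pauliPhase]

theorem pauli_mul (p q : Fin 4) :
    pauli p * pauli q = pauliPhase p q • pauli (pauliProd p q) := by
  fin_cases p <;> fin_cases q <;> ext i j <;> fin_cases i <;> fin_cases j <;>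
    simp [pauli, pauliPhase, pauliProd, Matrix.mul_apply]

theorem trace_pauli_mul (p q : Fin 4) :
    (pauli p * pauli q).trace = if p = q then 2 else 0 := by
  fin_cases p <;> fin_cases q <;>
    simp [pauli, Matrix.trace, one_add_one_eq_two]

theorem sum_pauli_mul_pauli (a b c d : Fin 2) :
    ∑ p, pauli p a b * pauli p c d = if a = d ∧ b = c then 2 else 0 := by
  fin_cases a <;> fin_cases b <;> fin_cases c <;> fin_cases d <;>
    simp [pauli, Fin.sum_univ_four, one_add_one_eq_two]

/-- This distributivity reduces identities for Pauli strings to identities for single-qubit Pauli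
matrices. -/
theorem sum_prod_eq_prod_sum {α : Type*} [Fintype α] (f : Fin N → α → ℂ) :
    ∑ t : Fin N → α, ∏ j, f j (t j) = ∏ j, ∑ a, f j a := by
  classical
  rw [Finset.prod_univ_sum, Fintype.piFinset_univ]

theorem conjTranspose_pauliOp (p : PauliString N) : (pauliOp p)ᴴ = pauliOp p := by
  ext s t
  simp only [pauliOp, Matrix.conjTranspose_apply, Matrix.of_apply, star_prod]
  refine Finset.prod_congr rfl fun j _ => ?_
  rw [← Matrix.conjTranspose_apply, conjTranspose_pauli]

theorem pauliOp_mul (p q : PauliString N) : pauliOp p * pauliOp q =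
    (∏ j, pauliPhase (p j) (q j)) • pauliOp fun j => pauliProd (p j) (q j) := by
  ext s t
  simp only [pauliOp, Matrix.mul_apply, Matrix.of_apply, Matrix.smul_apply, smul_eq_mul,
    ← Finset.prod_mul_distrib]
  rw [sum_prod_eq_prod_sum fun j a => pauli (p j) (s j) a * pauli (q j) a (t j)]
  refine Finset.prod_congr rfl fun j _ => ?_
  rw [← Matrix.mul_apply, pauli_mul, Matrix.smul_apply, smul_eq_mul]

theorem trace_pauliOp_mul (p q : PauliString N) :
    (pauliOp p * pauliOp q).trace = if p = q then 2 ^ N else 0 := by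
  have h : (pauliOp p * pauliOp q).trace = ∏ j, (pauli (p j) * pauli (q j)).trace := by
    simp only [Matrix.trace, Matrix.diag, pauliOp, Matrix.mul_apply, Matrix.of_apply,
      ← Finset.prod_mul_distrib]
    rw [← sum_prod_eq_prod_sum fun j a => ∑ b, pauli (p j) a b * pauli (q j) b a]
    refine Finset.sum_congr rfl fun s _ => ?_
    rw [sum_prod_eq_prod_sum fun j b => pauli (p j) (s j) b * pauli (q j) b (s j)]
  simp only [h, trace_pauli_mul]
  split_ifs with hpq
  · subst hpq; simp
  · obtain ⟨j, hj⟩ := Function.ne_iff.1 hpq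
    exact Finset.prod_eq_zero (Finset.mem_univ j) (if_neg hj)

theorem pauliOp_mul_self (p : PauliString N) : pauliOp p * pauliOp p = 1 := by
  ext s t
  simp only [pauliOp, Matrix.mul_apply, Matrix.of_apply, ← Finset.prod_mul_distrib]
  rw [sum_prod_eq_prod_sum fun j a => pauli (p j) (s j) a * pauli (p j) a (t j)]
  have h : ∀ q : Fin 4, pauli q * pauli q = 1 := fun q => by
    fin_cases q <;> ext i j <;> fin_cases i <;> fin_cases j <;> simp [pauli, Matrix.mul_apply]
  simp only [← Matrix.mul_apply, h, Matrix.one_apply]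
  split_ifs with hst
  · subst hst; simp
  · obtain ⟨j, hj⟩ := Function.ne_iff.1 hst
    exact Finset.prod_eq_zero (Finset.mem_univ j) (if_neg hj)

/-- The Pauli expansion. -/
theorem sum_pauliCoeff_smul (M : Op N) : ∑ p, pauliCoeff M p • pauliOp p = M := by
  ext s t
  -- Completeness of the Pauli strings, from the single-qubit relation `sum_pauli_mul_pauli` factor
  -- by factor.
  have h : ∀ a b : Qubits N, ∑ p : PauliString N, pauliOp p a b * pauliOp p s t =
      if a = t ∧ b = s then 2 ^ N else 0 := fun a b => by
    simp only [pauliOp, Matrix.of_apply, ← Finset.prod_mul_distrib]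
    rw [sum_prod_eq_prod_sum fun j q => pauli q (a j) (b j) * pauli q (s j) (t j)]
    simp only [sum_pauli_mul_pauli]
    split_ifs with hst
    · obtain ⟨rfl, rfl⟩ := hst; simp
    · rw [not_and_or] at hst
      rcases hst with hst | hst <;> obtain ⟨j, hj⟩ := Function.ne_iff.1 hst
      · exact Finset.prod_eq_zero (Finset.mem_univ j) (if_neg fun h => hj h.1)
      · exact Finset.prod_eq_zero (Finset.mem_univ j) (if_neg fun h => hj h.2)
  simp only [Matrix.sum_apply, Matrix.smul_apply, smul_eq_mul, pauliCoeff, Matrix.trace,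
    Matrix.diag, Matrix.mul_apply, Finset.sum_div, Finset.sum_mul]
  rw [Finset.sum_comm]
  have h' : ∀ a : Qubits N, ∑ p : PauliString N, ∑ b, pauliOp p a b * M b a / 2 ^ N * pauliOp p s t =
      if a = t then M s a else 0 := fun a => by
    rw [Finset.sum_comm]
    have : ∀ b : Qubits N, ∑ p : PauliString N, pauliOp p a b * M b a / 2 ^ N * pauliOp p s t =
        if a = t ∧ b = s then M b a else 0 := fun b => by
      have e : ∀ p : PauliString N, pauliOp p a b * M b a / 2 ^ N * pauliOp p s t =
          (pauliOp p a b * pauliOp p s t) * (M b a / 2 ^ N) := fun p => by ring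
      simp only [e]
      rw [← Finset.sum_mul, h, ite_mul, zero_mul]
      congr 1
      field_simp
    simp only [this]
    split_ifs with hat
    · simp [hat]
    · simp [hat]
  simp [h']

theorem pauliCoeff_add (X Y : Op N) (p : PauliString N) :
    pauliCoeff (X + Y) p = pauliCoeff X p + pauliCoeff Y p := by
  simp only [pauliCoeff, mul_add, Matrix.trace_add, add_div]

theorem pauliCoeff_smul (c : ℂ) (X : Op N) (p : PauliString N) :
    pauliCoeff (c • X) p = c * pauliCoeff X p := by
  simp only [pauliCoeff, mul_smul_comm, Matrix.trace_smul, smul_eq_mul, mul_div_assoc]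

theorem pauliNorm_add_le (X Y : Op N) : pauliNorm (X + Y) ≤ pauliNorm X + pauliNorm Y := by
  simp only [pauliNorm, ← Finset.sum_add_distrib, pauliCoeff_add]
  exact Finset.sum_le_sum fun p _ => norm_add_le _ _

theorem pauliNorm_smul (c : ℂ) (X : Op N) : pauliNorm (c • X) = ‖c‖ * pauliNorm X := by
  simp only [pauliNorm, pauliCoeff_smul, norm_mul, Finset.mul_sum]

theorem pauliNorm_nonneg (X : Op N) : 0 ≤ pauliNorm X :=
  Finset.sum_nonneg fun _ _ => norm_nonneg _

theorem pauliNorm_zero : pauliNorm (0 : Op N) = 0 := by simp [pauliNorm, pauliCoeff]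

theorem pauliNorm_sum_le {ι : Type*} (s : Finset ι) (f : ι → Op N) :
    pauliNorm (∑ i ∈ s, f i) ≤ ∑ i ∈ s, pauliNorm (f i) := by
  classical
  induction s using Finset.induction_on with
  | empty => simp [pauliNorm_zero]
  | insert i s hi ih =>
    rw [Finset.sum_insert hi, Finset.sum_insert hi]
    exact (pauliNorm_add_le _ _).trans (by gcongr)

theorem pauliNorm_pauliOp (p : PauliString N) : pauliNorm (pauliOp p) = 1 := by
  simp only [pauliNorm, pauliCoeff, trace_pauliOp_mul]
  rw [Finset.sum_eq_single p]
  · simp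
  · intro q _ hq; simp [hq]
  · simp

/-- The product of two Pauli strings is a Pauli string times a phase, so expanding both factors
loses nothing beyond the triangle inequality. -/
theorem pauliNorm_mul_le (X Y : Op N) : pauliNorm (X * Y) ≤ pauliNorm X * pauliNorm Y := by
  have e : X * Y = ∑ p, ∑ q, (pauliCoeff X p * pauliCoeff Y q) • (pauliOp p * pauliOp q) := by
    conv_lhs => rw [← sum_pauliCoeff_smul X, ← sum_pauliCoeff_smul Y]
    simp only [Finset.sum_mul_sum, smul_mul_smul_comm]
  have h : ∀ p q : PauliString N, pauliNorm (pauliOp p * pauliOp q) = 1 := fun p q => by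
    rw [pauliOp_mul, pauliNorm_smul, pauliNorm_pauliOp, norm_prod]
    simp [norm_pauliPhase]
  calc pauliNorm (X * Y) ≤ ∑ p, ∑ q, ‖pauliCoeff X p‖ * ‖pauliCoeff Y q‖ := by
        rw [e]
        refine (pauliNorm_sum_le _ _).trans (Finset.sum_le_sum fun p _ =>
          (pauliNorm_sum_le _ _).trans (Finset.sum_le_sum fun q _ => ?_))
        rw [pauliNorm_smul, h, mul_one, norm_mul]
    _ = _ := by rw [pauliNorm, pauliNorm, Finset.sum_mul_sum]

theorem isAlgSeminorm_pauliNorm : IsAlgSeminorm (pauliNorm (N := N)) :=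
  ⟨pauliNorm_add_le, pauliNorm_smul, pauliNorm_mul_le⟩

theorem isAlgSeminorm_norm {𝒜 : Type*} [NormedRing 𝒜] [NormedAlgebra ℂ 𝒜] :
    IsAlgSeminorm fun X : 𝒜 => ‖X‖ :=
  ⟨norm_add_le, norm_smul, norm_mul_le⟩

theorem eq_zero_of_pauliNorm_eq_zero {X : Op N} (h : pauliNorm X = 0) : X = 0 := by
  rw [← sum_pauliCoeff_smul X]
  refine Finset.sum_eq_zero fun p _ => ?_
  rw [norm_eq_zero.1 ((Finset.sum_eq_zero_iff_of_nonneg fun _ _ => norm_nonneg _).1 h p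
    (Finset.mem_univ p)), zero_smul]

theorem pauliCoeff_of_skew {X : Op N} (hX : Xᴴ = -X) (p : PauliString N) :
    pauliCoeff X p = Complex.I * ((pauliCoeff X p).im : ℂ) := by
  have h : star (pauliCoeff X p) = -pauliCoeff X p := by
    rw [pauliCoeff, star_div₀, ← Matrix.trace_conjTranspose, Matrix.conjTranspose_mul, hX,
      conjTranspose_pauliOp, neg_mul, Matrix.trace_neg, Matrix.trace_mul_comm, neg_div]
    simp
  have h1 := congrArg Complex.re h
  simp only [Complex.star_def, Complex.conj_re, Complex.neg_re] at h1
  apply Complex.ext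
  · simp; linarith
  · simp

end Pauli

/-! ### Operators on disjoint sets of qubits -/

/-- In the sum over intermediate basis labels only one survives: it agrees with t on S and with s
off S. The result is symmetric in the two factors, which is why they commute. -/
theorem ActsOn.mul_apply {N : ℕ} {S S' : Set (Fin N)} (hS : Disjoint S S') {M M' : Op N}
    {T : Matrix (S → Fin 2) (S → Fin 2) ℂ} {T' : Matrix (S' → Fin 2) (S' → Fin 2) ℂ}
    [∀ s t : Qubits N, Decidable (∀ v, v ∉ S → s v = t v)]
    [∀ s t : Qubits N, Decidable (∀ v, v ∉ S' → s v = t v)]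
    [∀ s t : Qubits N, Decidable (∀ v, v ∉ S ∪ S' → s v = t v)]
    (hM : ∀ s t : Qubits N,
      M s t = if ∀ v, v ∉ S → s v = t v then T (fun v => s v) (fun v => t v) else 0)
    (hM' : ∀ s t : Qubits N,
      M' s t = if ∀ v, v ∉ S' → s v = t v then T' (fun v => s v) (fun v => t v) else 0)
    (s t : Qubits N) :
    (M * M') s t = if ∀ v, v ∉ S ∪ S' → s v = t v then
      T (fun v => s v) (fun v => t v) * T' (fun v => s v) (fun v => t v) else 0 := by
  classical
  rw [Matrix.mul_apply]
  let r : Qubits N := fun v => if v ∈ S then t v else s v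
  have hr1 : ∀ v, v ∉ S → s v = r v := fun v hv => by simp [r, hv]
  have hrS : (fun v : S => r v) = fun v : S => t v := by funext v; simp [r]
  have hrS' : (fun v : S' => r v) = fun v : S' => s v := by
    funext v; simp [r, Set.disjoint_right.1 hS v.2]
  rw [Finset.sum_eq_single r]
  · rw [hM, hM', if_pos hr1, hrS, hrS']
    have : (∀ v, v ∉ S' → r v = t v) ↔ ∀ v, v ∉ S ∪ S' → s v = t v := by
      refine ⟨fun h v hv => ?_, fun h v hv => ?_⟩
      · rw [Set.mem_union, not_or] at hv
        rw [← h v hv.2]; simp [r, hv.1]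
      · by_cases hvS : v ∈ S
        · simp [r, hvS]
        · simp only [r, hvS, if_false]; exact h v (by simp [hvS, hv])
    simp only [this, mul_ite, mul_zero]
  · intro q _ hq
    rw [hM, hM']
    by_cases h1 : ∀ v, v ∉ S → s v = q v
    · by_cases h2 : ∀ v, v ∉ S' → q v = t v
      · refine absurd (funext fun v => ?_) hq
        by_cases hv : v ∈ S
        · simp only [r, hv, if_true]; exact h2 v (Set.disjoint_left.1 hS hv)
        · simp only [r, hv, if_false]; exact (h1 v hv).symm
      · rw [if_neg h2, mul_zero]
    · rw [if_neg h1, zero_mul]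
  · simp

theorem ActsOn.commute {N : ℕ} {S S' : Set (Fin N)} (hS : Disjoint S S') {M M' : Op N}
    (hM : ActsOn S M) (hM' : ActsOn S' M') : Commute M M' := by
  classical
  obtain ⟨T, hT⟩ := hM
  obtain ⟨T', hT'⟩ := hM'
  ext s t
  rw [ActsOn.mul_apply hS hT hT', ActsOn.mul_apply hS.symm hT' hT]
  simp only [Set.union_comm S' S, mul_comm]

/-! ### Lattice Hamiltonians as chains -/

theorem hasDerivAt_comp_ofReal {E : Type*} [NormedAddCommGroup E] [NormedSpace ℂ E] {f : ℂ → E}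
    {f' : E} {x : ℝ} (hf : HasDerivAt f f' (x : ℂ)) : HasDerivAt (fun y : ℝ => f y) f' x := by
  have := hf.scomp x Complex.ofRealCLM.hasDerivAt
  simpa [Function.comp_def] using this

namespace LatticeHamiltonian

variable {n N : ℕ} (h : LatticeHamiltonian n N) (K : ℕ)

open Classical in
/-- The bonds that meet the bond `j`. -/
def nbhd (N : ℕ) {n : ℕ} (j : Fin n) : Finset (Fin n) :=
  Finset.univ.filter fun i => ¬Disjoint (bond N i) (bond N j)

include h in
theorem le_sites : n ≤ N := by rcases h.geometry with h | h <;> omega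

theorem add_one_mod_inj {i j : ℕ} (hi : i < N) (hj : j < N)
    (hij : (i + 1) % N = (j + 1) % N) : i = j := by
  rcases Nat.lt_or_ge (i + 1) N with h1 | h1 <;> rcases Nat.lt_or_ge (j + 1) N with h2 | h2
  · rw [Nat.mod_eq_of_lt h1, Nat.mod_eq_of_lt h2] at hij; omega
  · rw [Nat.mod_eq_of_lt h1, show j + 1 = N by omega, Nat.mod_self] at hij; omega
  · rw [Nat.mod_eq_of_lt h2, show i + 1 = N by omega, Nat.mod_self] at hij; omega
  · omega

theorem isChain : IsChain h.term (nbhd N) where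
  self_mem j := by
    have := h.le_sites
    simp only [nbhd, Finset.mem_filter, Finset.mem_univ, true_and, disjoint_self]
    intro h0
    have : (⟨j, j.2.trans_le this⟩ : Fin N) ∈ bond N j := .inl rfl
    rw [h0] at this
    exact this
  symm i j hij := by
    simp only [nbhd, Finset.mem_filter, Finset.mem_univ, true_and] at hij ⊢
    rwa [disjoint_comm]
  card_le j := by
    classical
    have hN := h.le_sites
    -- Bonds {i, i+1} and {j, j+1} meet only if i = j, i = j + 1 or i + 1 = j modulo N; n ≤ N makes
    -- each of these determine i.
    have hsub : nbhd N j ⊆ {j} ∪ (Finset.univ.filter fun i : Fin n => (i : ℕ) = (j + 1) % N) ∪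
        (Finset.univ.filter fun i : Fin n => ((i : ℕ) + 1) % N = j) := by
      intro i hi
      simp only [nbhd, Finset.mem_filter, Finset.mem_univ, true_and, Set.not_disjoint_iff] at hi
      obtain ⟨v, hv | hv, hv' | hv'⟩ := hi <;>
        simp only [Finset.mem_union, Finset.mem_singleton, Finset.mem_filter, Finset.mem_univ,
          true_and]
      · exact .inl (.inl (Fin.ext (hv.symm.trans hv')))
      · exact .inl (.inr (hv.symm.trans hv'))
      · exact .inr (hv.symm.trans hv')
      · exact .inl (.inl (Fin.ext (add_one_mod_inj (i.2.trans_le hN) (j.2.trans_le hN)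
          (hv.symm.trans hv'))))
    have h1 : (Finset.univ.filter fun i : Fin n => (i : ℕ) = (j + 1) % N).card ≤ 1 :=
      Finset.card_le_one.2 fun a ha b hb => by
        simp only [Finset.mem_filter, Finset.mem_univ, true_and] at ha hb
        exact Fin.ext (ha.trans hb.symm)
    have h2 : (Finset.univ.filter fun i : Fin n => ((i : ℕ) + 1) % N = j).card ≤ 1 :=
      Finset.card_le_one.2 fun a ha b hb => by
        simp only [Finset.mem_filter, Finset.mem_univ, true_and] at ha hb
        exact Fin.ext (add_one_mod_inj (a.2.trans_le hN) (b.2.trans_le hN) (ha.trans hb.symm))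
    calc _ ≤ _ := Finset.card_le_card hsub
      _ ≤ _ := Finset.card_union_le _ _
      _ ≤ ({j} : Finset (Fin n)).card + 1 + 1 :=
        add_le_add ((Finset.card_union_le _ _).trans (add_le_add le_rfl h1)) h2
      _ = 3 := by simp
  comm i j hij := by
    simp only [nbhd, Finset.mem_filter, Finset.mem_univ, true_and, not_not] at hij
    exact ActsOn.commute hij (h.actsOn i) (h.actsOn j)

/-- The bonds of either parity. -/
def parityBonds (n : ℕ) : Bool → Finset (Fin n)
  | true => Finset.univ.filter fun j : Fin n => Even (j : ℕ)
  | false => Finset.univ.filter fun j : Fin n => Odd (j : ℕ)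

theorem card_parityBonds (n : ℕ) :
    (parityBonds n true).card + (parityBonds n false).card = n := by
  have := Finset.card_filter_add_card_filter_not (s := (Finset.univ : Finset (Fin n)))
    (fun j => Even (j : ℕ))
  simpa [parityBonds, Nat.not_even_iff_odd] using this

/-- The pair `A`, `B`. -/
def parts (b : Bool) : Op N := ∑ j ∈ parityBonds n b, h.term j

theorem H_eq : h.H = h.parts true + h.parts false := by
  have := Finset.sum_filter_add_sum_filter_not (Finset.univ : Finset (Fin n))
    (fun j => Even (j : ℕ)) h.term
  simp only [Nat.not_even_iff_odd] at this
  exact this.symm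

theorem isHermitian_sum (E : Finset (Fin n)) : (∑ j ∈ E, h.term j).IsHermitian := by
  rw [Matrix.IsHermitian, Matrix.conjTranspose_sum]
  exact Finset.sum_congr rfl fun j _ => h.isHermitian j

theorem isHermitian_parts (b : Bool) : (h.parts b).IsHermitian := h.isHermitian_sum _

theorem isHermitian_H : h.H.IsHermitian := h.isHermitian_sum _

/-- `S (d/dz S⁻¹ - i H S⁻¹)` in complex time. -/
def gen : ℂ → Op N := layersGen h.H h.parts (trotterLayers K)

instance (m : Type) [Fintype m] [DecidableEq m] : CompleteSpace (Matrix m m ℂ) := complete_matrix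

theorem differentiable_gen : Differentiable ℂ (h.gen K) := differentiable_layersGen _ _ _

theorem S_eq (x : ℝ) : h.S K x = layers h.parts (trotterLayers K) (x : ℂ) :=
  trotter_eq h.parts K x

theorem conjTranspose_S (x : ℝ) : (h.S K x)ᴴ = layersInv h.parts (trotterLayers K) (x : ℂ) := by
  rw [S_eq, conjTranspose_layers h.isHermitian_parts]

theorem V_eq (x : ℝ) : h.V K x = layersRem h.H h.parts (trotterLayers K) (x : ℂ) := by
  rw [V, conjTranspose_S]; rfl

theorem J_eq (x : ℝ) : h.J K x = h.gen K (x : ℂ) := by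
  have e : (fun y : ℝ => (h.S K y)ᴴ) =
      fun y : ℝ => layersInv h.parts (trotterLayers K) (y : ℂ) := funext (h.conjTranspose_S K)
  rw [J, R, e, (hasDerivAt_comp_ofReal (hasDerivAt_layersInv h.H h.parts (trotterLayers K) x)).deriv,
    conjTranspose_S, S_eq, smul_mul_assoc, add_sub_cancel_right, ← mul_assoc,
    layers_mul_layersInv, one_mul]
  rfl

theorem iteratedDeriv_J (s : ℕ) :
    iteratedDeriv s (h.J K) = fun x : ℝ => iteratedDeriv s (h.gen K) (x : ℂ) := by
  induction s with
  | zero => funext x; simpa using h.J_eq K x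
  | succ s ih =>
    rw [iteratedDeriv_succ, ih, iteratedDeriv_succ]
    funext x
    exact (hasDerivAt_comp_ofReal
      (differentiable_iteratedDeriv (h.differentiable_gen K) s x).hasDerivAt).deriv

theorem C_eq (s : ℕ) : h.C K s = iteratedDeriv s (h.gen K) 0 := by
  simp only [C, iteratedDeriv_J, Complex.ofReal_zero]

theorem conjTranspose_C (s : ℕ) : (h.C K s)ᴴ = -h.C K s := by
  have key : ∀ x : ℝ, (iteratedDeriv s (h.J K) x)ᴴ = -iteratedDeriv s (h.J K) x := by
    induction s with
    | zero =>
      intro x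
      simp only [iteratedDeriv_zero, J_eq]
      exact conjTranspose_layersGen h.isHermitian_H h.isHermitian_parts _ x
    | succ s ih =>
      intro x
      -- The adjoint commutes with differentiation in a real variable, so anti-Hermiticity on the
      -- whole real line passes to the next derivative.
      have e : (fun x => star (iteratedDeriv s (h.J K) x)) = -iteratedDeriv s (h.J K) :=
        funext ih
      rw [iteratedDeriv_succ, ← Matrix.star_eq_conjTranspose, ← deriv.star, e, deriv.neg]
  exact key 0

/-! ### Vanishing and size of the coefficients C_s -/

variable {K}

theorem C_eq_zero (hK : K = 1 ∨ ∃ k : ℕ, 1 ≤ k ∧ K = 2 * k) {s : ℕ} (hs : s < K) :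
    h.C K s = 0 := by
  obtain ⟨R, hR⟩ := exists_approxEvol_trotterLayers h.parts hK
  rw [← H_eq] at hR
  obtain ⟨g, hg, hJ⟩ := hR.layersGen_eq
  have e : h.gen K = fun z => z ^ K • g z := funext hJ
  rw [C_eq, e]
  exact iteratedDeriv_pow_smul_eq_zero hg hs

/-- The layers have total length 2W, which gives the base 4WΛ. The prefactor collects n terms from H
and nW from the layers, as A and B together have n bonds. -/
theorem seminorm_C_le (hK : K = 1 ∨ ∃ k : ℕ, 1 ≤ k ∧ K = 2 * k) {ν : Op N → ℝ}
    (hν : IsAlgSeminorm ν) {Λ : ℝ} (hΛ0 : 0 ≤ Λ) (hΛ : ∀ j, ν (h.term j) ≤ Λ) (s : ℕ) :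
    ν (h.C K s) ≤ n * (1 + trotterWeight K) * Λ * (4 * trotterWeight K * Λ) ^ s *
      ((s + 2).factorial / 2) := by
  classical
  have h1 := norm_iteratedDeriv_layersGen_le h.isChain hν hΛ0 hΛ (parityBonds n) Finset.univ
    (trotterLayers K) s
  have h2 := sum_trotterLayers hK fun _ => 1
  simp only [mul_one] at h2
  have h3 : ((parityBonds n true).card : ℝ) + ((parityBonds n false).card : ℝ) = n := by
    exact_mod_cast card_parityBonds n
  rw [sum_trotterLayers hK fun b => ((parityBonds n b).card : ℝ), h3, h2] at h1
  rw [C_eq]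
  refine h1.trans (le_of_eq ?_)
  rw [Finset.card_univ, Fintype.card_fin]
  ring

theorem le_Lam (j : Fin n) : ‖h.term j‖ ≤ h.Lam :=
  le_ciSup (f := fun j => ‖h.term j‖) (Set.finite_range _).bddAbove j

theorem le_Lam1 (j : Fin n) : pauliNorm (h.term j) ≤ h.Lam1 :=
  le_ciSup (f := fun j => pauliNorm (h.term j)) (Set.finite_range _).bddAbove j

theorem Lam_nonneg : 0 ≤ h.Lam := Real.iSup_nonneg fun _ => norm_nonneg _

theorem Lam1_nonneg : 0 ≤ h.Lam1 := Real.iSup_nonneg fun _ => pauliNorm_nonneg _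

theorem norm_C_le (hK : K = 1 ∨ ∃ k : ℕ, 1 ≤ k ∧ K = 2 * k) (s : ℕ) :
    ‖h.C K s‖ ≤ n * (1 + trotterWeight K) * h.Lam * (4 * trotterWeight K * h.Lam) ^ s *
      ((s + 2).factorial / 2) :=
  h.seminorm_C_le hK isAlgSeminorm_norm h.Lam_nonneg h.le_Lam s

theorem pauliNorm_C_le (hK : K = 1 ∨ ∃ k : ℕ, 1 ≤ k ∧ K = 2 * k) (s : ℕ) :
    pauliNorm (h.C K s) ≤ n * (1 + trotterWeight K) * h.Lam1 *
      (4 * trotterWeight K * h.Lam1) ^ s * ((s + 2).factorial / 2) :=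
  h.seminorm_C_le hK isAlgSeminorm_pauliNorm h.Lam1_nonneg h.le_Lam1 s

end LatticeHamiltonian

/-! ### The truncation error -/

/-- The sum of the series `∑ j, (j + m + 2).choose 2 * θ ^ j`. -/
def geomTail (m : ℕ) (θ : ℝ) : ℝ :=
  1 / (1 - θ) ^ 3 + m * (1 / (1 - θ) ^ 2) + m * (m + 1) / 2 * (1 / (1 - θ))

/-- Splitting binom(j+m+2, 2) = binom(j+2, 2) + m (j+1) + m(m+1)/2 leaves three standard series. -/
theorem hasSum_geomTail (m : ℕ) {θ : ℝ} (h0 : 0 ≤ θ) (h1 : θ < 1) :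
    HasSum (fun j : ℕ => ((j + m + 2 : ℝ) * (j + m + 1) / 2) * θ ^ j) (geomTail m θ) := by
  have hθ : ‖θ‖ < 1 := by rwa [Real.norm_of_nonneg h0]
  have h2 := hasSum_choose_mul_geometric_of_norm_lt_one 2 hθ
  have h3 := (hasSum_choose_mul_geometric_of_norm_lt_one 1 hθ).mul_left (m : ℝ)
  have h4 := (hasSum_geometric_of_lt_one h0 h1).mul_left ((m : ℝ) * (m + 1) / 2)
  have h5 := (h2.add h3).add h4
  rw [← one_div] at h5
  have e : (fun j : ℕ => ((j + m + 2 : ℝ) * (j + m + 1) / 2) * θ ^ j) = fun j : ℕ =>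
      ((j + 2).choose 2 : ℝ) * θ ^ j + m * ((j + 1).choose 1 * θ ^ j) +
        m * (m + 1) / 2 * θ ^ j := by
    funext j
    rw [Nat.cast_choose_two, Nat.choose_one_right]
    push_cast
    ring
  rw [e]
  exact h5

namespace LatticeHamiltonian

variable {n N : ℕ} (h : LatticeHamiltonian n N) {K : ℕ}

theorem expI_mem_unitary {m : Type} [Fintype m] [DecidableEq m] {A : Matrix m m ℂ}
    (hA : A.IsHermitian) (x : ℝ) : expI A (x : ℂ) ∈ Matrix.unitaryGroup m ℂ := by
  rw [Matrix.mem_unitaryGroup_iff, Matrix.star_eq_conjTranspose, conjTranspose_expI hA,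
    expI_mul_neg]

theorem S_mem_unitary (K : ℕ) (x : ℝ) : h.S K x ∈ Matrix.unitaryGroup (Qubits N) ℂ := by
  rw [Matrix.mem_unitaryGroup_iff, Matrix.star_eq_conjTranspose, conjTranspose_S, S_eq,
    layers_mul_layersInv]

theorem V_mem_unitary (K : ℕ) (x : ℝ) : h.V K x ∈ Matrix.unitaryGroup (Qubits N) ℂ :=
  mul_mem (expI_mem_unitary h.isHermitian_H x) (Unitary.star_mem (h.S_mem_unitary K x))

theorem norm_le_one_of_mem_unitary {m : Type} [Fintype m] [DecidableEq m] [Nonempty m]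
    {M : Matrix m m ℂ} (hM : M ∈ Matrix.unitaryGroup m ℂ) : ‖M‖ ≤ 1 :=
  (CStarRing.norm_of_mem_unitary hM).le

theorem hasSum_gen (t : ℝ) :
    HasSum (fun s : ℕ => ((t ^ s / s.factorial : ℝ) : ℂ) • h.C K s) (h.gen K (t : ℂ)) := by
  have := Complex.hasSum_taylorSeries_of_entire (h.differentiable_gen K) 0 (t : ℂ)
  have e : (fun s : ℕ => ((t ^ s / s.factorial : ℝ) : ℂ) • h.C K s) = fun s : ℕ =>
      (s.factorial : ℂ)⁻¹ • ((t : ℂ) - 0) ^ s • iteratedDeriv s (h.gen K) 0 := by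
    funext s
    rw [C_eq, sub_zero, smul_smul]
    congr 1
    push_cast
    ring
  rw [e]
  exact this

/-- Tail of the Taylor series of J. Dividing the bound on C_{j+m} by (j+m)! leaves (j+m+2)(j+m+1)/2
times a geometric factor, estimated at t = x to make the constant uniform in t. -/
theorem norm_gen_sub_le (hK : K = 1 ∨ ∃ k : ℕ, 1 ≤ k ∧ K = 2 * k) {x t : ℝ} (ht : 0 ≤ t)
    (htx : t ≤ x) (hx : 4 * trotterWeight K * h.Lam * x < 1) (m : ℕ) :
    ‖h.gen K (t : ℂ) - ∑ s ∈ Finset.range m, ((t ^ s / s.factorial : ℝ) : ℂ) • h.C K s‖ ≤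
      n * (1 + trotterWeight K) * h.Lam * (4 * trotterWeight K * h.Lam) ^ m *
        geomTail m (4 * trotterWeight K * h.Lam * x) * t ^ m := by
  set p := 4 * trotterWeight K * h.Lam with hp
  have hw := trotterWeight_pos K
  have hL := h.Lam_nonneg
  have hp0 : 0 ≤ p := by positivity
  have hs := (hasSum_nat_add_iff' m).2 (h.hasSum_gen (K := K) t)
  have hg := (hasSum_geomTail m (mul_nonneg hp0 (ht.trans htx)) hx).mul_left
    (n * (1 + trotterWeight K) * h.Lam * p ^ m * t ^ m)
  rw [← hs.tsum_eq]
  refine (tsum_of_norm_bounded hg fun j => ?_).trans (le_of_eq (by ring))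
  have hf : (0 : ℝ) < (j + m).factorial := by positivity
  have hC := h.norm_C_le hK (j + m)
  rw [norm_smul, Complex.norm_real, Real.norm_of_nonneg (by positivity)]
  have h1 : t ^ j ≤ x ^ j := pow_le_pow_left₀ ht htx j
  calc t ^ (j + m) / (j + m).factorial * ‖h.C K (j + m)‖ ≤
      t ^ (j + m) / (j + m).factorial * (n * (1 + trotterWeight K) * h.Lam * p ^ (j + m) *
        ((j + m + 2).factorial / 2)) := mul_le_mul_of_nonneg_left hC (by positivity)
    _ = n * (1 + trotterWeight K) * h.Lam * p ^ m * t ^ m *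
        ((j + m + 2 : ℝ) * (j + m + 1) / 2 * (p ^ j * t ^ j)) := by
      rw [Nat.factorial_succ, Nat.factorial_succ]
      push_cast
      field_simp
      ring
    _ ≤ _ := by
      have : p ^ j * t ^ j ≤ (p * x) ^ j := by
        rw [mul_pow p x j]; exact mul_le_mul_of_nonneg_left h1 (by positivity)
      gcongr

theorem hasDerivAt_V (t : ℝ) : HasDerivAt (h.V K) (h.V K t * h.gen K (t : ℂ)) t := by
  have e : h.V K = fun x : ℝ => layersRem h.H h.parts (trotterLayers K) (x : ℂ) :=
    funext (h.V_eq K)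
  rw [e]
  exact hasDerivAt_comp_ofReal (hasDerivAt_layersRem h.H h.parts (trotterLayers K) t)

theorem V_zero : h.V K 0 = 1 := by
  have h1 : ∀ l, layersInv h.parts l 0 = 1 := fun l => by
    induction l with
    | nil => rfl
    | cons p l ih => rw [layersInv, ih, mul_zero, neg_zero, expI_zero, one_mul]
  rw [V_eq, layersRem, Complex.ofReal_zero, expI_zero, h1, one_mul]

theorem sum_range_C (hK : K = 1 ∨ ∃ k : ℕ, 1 ≤ k ∧ K = 2 * k) (f : ℕ → ℂ) :
    ∑ s ∈ Finset.range K, f s • h.C K s = 0 :=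
  Finset.sum_eq_zero fun s hs => by
    rw [h.C_eq_zero hK (Finset.mem_range.1 hs), smul_zero]

theorem Vtilde_eq (hK : K = 1 ∨ ∃ k : ℕ, 1 ≤ k ∧ K = 2 * k) (x : ℝ) :
    h.Vtilde K x = 1 + ∑ s ∈ Finset.range (2 * K + 1),
      ((x ^ (s + 1) / (s + 1).factorial : ℝ) : ℂ) • h.C K s := by
  rw [Vtilde, ← Finset.sum_range_add_sum_Ico _ (show K ≤ 2 * K + 1 by omega),
    h.sum_range_C hK, zero_add, ← Finset.Ico_add_one_right_eq_Icc,
    ← Finset.sum_Ico_add' (fun s => h.F K s x)]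
  rfl

theorem hasDerivAt_Vtilde (hK : K = 1 ∨ ∃ k : ℕ, 1 ≤ k ∧ K = 2 * k) (t : ℝ) :
    HasDerivAt (h.Vtilde K)
      (∑ s ∈ Finset.range (2 * K + 1), ((t ^ s / s.factorial : ℝ) : ℂ) • h.C K s) t := by
  have e : h.Vtilde K = fun x => 1 + ∑ s ∈ Finset.range (2 * K + 1),
      ((x ^ (s + 1) / (s + 1).factorial : ℝ) : ℂ) • h.C K s := funext (h.Vtilde_eq hK)
  rw [e]
  refine (HasDerivAt.fun_sum fun s _ => ?_).const_add 1
  have h1 : HasDerivAt (fun x : ℝ => ((x ^ (s + 1) / (s + 1).factorial : ℝ) : ℂ))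
      ((t ^ s / s.factorial : ℝ) : ℂ) t := by
    have h2 : HasDerivAt (fun x : ℝ => x ^ (s + 1) / ((s + 1).factorial : ℝ))
        (t ^ s / s.factorial) t := by
      refine ((hasDerivAt_pow (s + 1) t).div_const _).congr_deriv ?_
      rw [Nat.factorial_succ]
      push_cast
      field_simp
    exact h2.ofReal_comp
  exact h1.smul_const _

/-- With T the Taylor polynomial of J of degree 2K, the derivative of V - Ṽ is (V - 1) J + (J - T).
Unitarity of V gives ‖V - 1‖ ≤ ∫‖J‖ ≤ D₁ t^{K+1}/(K+1), so both parts are O(t^{2K+1}); integrating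
gives the two terms. -/
theorem eps_le_of_lt_one (hK : K = 1 ∨ ∃ k : ℕ, 1 ≤ k ∧ K = 2 * k) {x : ℝ} (hx0 : 0 ≤ x)
    (hx : 4 * trotterWeight K * h.Lam * x < 1) :
    h.eps K x ≤
      (n * (1 + trotterWeight K) * h.Lam * (4 * trotterWeight K * h.Lam) ^ K *
        geomTail K (4 * trotterWeight K * h.Lam * x)) ^ 2 * x ^ (2 * K + 2) / (2 * (K + 1) ^ 2) +
      n * (1 + trotterWeight K) * h.Lam * (4 * trotterWeight K * h.Lam) ^ (2 * K + 1) *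
        geomTail (2 * K + 1) (4 * trotterWeight K * h.Lam * x) * x ^ (2 * K + 2) / (2 * K + 2) := by
  set D₁ := n * (1 + trotterWeight K) * h.Lam * (4 * trotterWeight K * h.Lam) ^ K *
        geomTail K (4 * trotterWeight K * h.Lam * x) with hD₁
  set D₂ := n * (1 + trotterWeight K) * h.Lam * (4 * trotterWeight K * h.Lam) ^ (2 * K + 1) *
        geomTail (2 * K + 1) (4 * trotterWeight K * h.Lam * x) with hD₂
  have hJ : ∀ t ∈ Set.Icc 0 x, ‖h.gen K (t : ℂ)‖ ≤ D₁ * t ^ K := fun t ht => by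
    have := h.norm_gen_sub_le hK ht.1 ht.2 hx K
    rwa [h.sum_range_C hK, sub_zero] at this
  have hV : ∀ t ∈ Set.Icc 0 x, ‖h.V K t - 1‖ ≤ D₁ / (K + 1) * t ^ (K + 1) := by
    refine image_norm_le_of_norm_deriv_right_le_deriv_boundary
      (f' := fun t => h.V K t * h.gen K (t : ℂ)) (B' := fun t => D₁ * t ^ K)
      (fun t _ => ((h.hasDerivAt_V t).sub_const 1).continuousAt.continuousWithinAt)
      (fun t _ => ((h.hasDerivAt_V t).sub_const 1).hasDerivWithinAt) ?_ ?_ ?_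
    · simp [V_zero]
    · intro t
      refine ((hasDerivAt_pow (K + 1) t).const_mul (D₁ / (K + 1))).congr_deriv ?_
      push_cast
      field_simp
    · intro t ht
      calc ‖h.V K t * h.gen K (t : ℂ)‖ ≤ ‖h.V K t‖ * ‖h.gen K (t : ℂ)‖ := norm_mul_le _ _
        _ ≤ 1 * ‖h.gen K (t : ℂ)‖ := mul_le_mul_of_nonneg_right
            (norm_le_one_of_mem_unitary (h.V_mem_unitary K t)) (norm_nonneg _)
        _ ≤ _ := by rw [one_mul]; exact hJ t ⟨ht.1, ht.2.le⟩
  have hd : ∀ t : ℝ, HasDerivAt (fun t => h.V K t - h.Vtilde K t)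
      ((h.V K t - 1) * h.gen K (t : ℂ) + (h.gen K (t : ℂ) -
        ∑ s ∈ Finset.range (2 * K + 1), ((t ^ s / s.factorial : ℝ) : ℂ) • h.C K s)) t :=
    fun t => ((h.hasDerivAt_V t).sub (h.hasDerivAt_Vtilde hK t)).congr_deriv (by noncomm_ring)
  have hB : ∀ t ∈ Set.Icc 0 x, ‖h.V K t - h.Vtilde K t‖ ≤
      (D₁ ^ 2 / (2 * (K + 1) ^ 2) + D₂ / (2 * K + 2)) * t ^ (2 * K + 2) := by
    refine image_norm_le_of_norm_deriv_right_le_deriv_boundary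
      (B' := fun t => (D₁ ^ 2 / (K + 1) + D₂) * t ^ (2 * K + 1))
      (fun t _ => (hd t).continuousAt.continuousWithinAt)
      (fun t _ => (hd t).hasDerivWithinAt) ?_ ?_ ?_
    · simp [V_zero, h.Vtilde_eq hK]
    · intro t
      refine ((hasDerivAt_pow (2 * K + 2) t).const_mul _).congr_deriv ?_
      push_cast
      field_simp
    · intro t ht
      have ht' : t ∈ Set.Icc 0 x := ⟨ht.1, ht.2.le⟩
      have h1 := mul_le_mul (hV t ht') (hJ t ht') (norm_nonneg _) ((norm_nonneg _).trans (hV t ht'))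
      have h2 := h.norm_gen_sub_le hK ht.1 ht.2.le hx (2 * K + 1)
      refine (norm_add_le _ _).trans ((add_le_add ((norm_mul_le _ _).trans h1) h2).trans
        (le_of_eq ?_))
      rw [← hD₂]
      field_simp
      ring
  have := hB x ⟨hx0, le_rfl⟩
  rw [eps, norm_sub_rev]
  refine this.trans (le_of_eq (by ring))

end LatticeHamiltonian

/-! ### Numerical estimates -/

theorem geomTail_mono (m : ℕ) {θ c : ℝ} (hθ : θ ≤ c) (hc : c < 1) :
    geomTail m θ ≤ geomTail m c := by
  have h1 : 0 < 1 - c := by linarith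
  have h2 : 1 - c ≤ 1 - θ := by linarith
  rw [geomTail, geomTail]
  gcongr

theorem geomTail_nonneg (m : ℕ) {θ : ℝ} (hθ : θ < 1) : 0 ≤ geomTail m θ := by
  have h1 : 0 < 1 - θ := by linarith
  rw [geomTail]
  positivity

theorem geomTail_le (m : ℕ) (hm : 4 ≤ m) {θ : ℝ} (hθ : θ ≤ 81 / 100) :
    geomTail m θ ≤ 11 * (m + 1) * (m + 2) := by
  refine (geomTail_mono m hθ (by norm_num)).trans ?_
  have hm' : (4 : ℝ) ≤ m := by exact_mod_cast hm
  rw [geomTail]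
  norm_num
  nlinarith

/-- The inductive step is Bernoulli's inequality (1 + 1/(K+1))^{K+1} ≥ 2. -/
theorem factorial_le_half_pow (K : ℕ) : (K.factorial : ℝ) ≤ ((K + 1) / 2) ^ K := by
  induction K with
  | zero => simp
  | succ K ih =>
    have h1 : (2 : ℝ) ≤ (1 + 1 / (K + 1)) ^ (K + 1) := by
      have := one_add_mul_le_pow (a := 1 / ((K : ℝ) + 1))
        (by have : (0 : ℝ) ≤ 1 / ((K : ℝ) + 1) := by positivity
            linarith) (K + 1)
      push_cast at this
      rw [mul_one_div_cancel (by positivity)] at this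
      linarith
    rw [Nat.factorial_succ]
    push_cast
    calc ((K : ℝ) + 1) * K.factorial ≤ (K + 1) * ((K + 1) / 2) ^ K := by gcongr
      _ = 2 * ((K + 1) / 2) ^ (K + 1) := by rw [pow_succ]; ring
      _ ≤ (1 + 1 / (K + 1)) ^ (K + 1) * ((K + 1) / 2) ^ (K + 1) := by gcongr
      _ = ((K + 1 + 1) / 2) ^ (K + 1) := by
        rw [← mul_pow]; congr 1; field_simp

theorem cubic_le_six_pow {K : ℕ} (hK : 4 ≤ K) : 7 * (K + 2) ^ 2 * (K + 1) ≤ 6 ^ K := by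
  induction K, hK using Nat.le_induction with
  | base => norm_num
  | succ K hK ih =>
    rw [pow_succ 6 K]
    nlinarith [Nat.mul_le_mul hK hK, Nat.mul_le_mul (Nat.mul_le_mul hK hK) hK]

theorem sq_le_two_pow {K : ℕ} (hK : 4 ≤ K) : (K + 1) ^ 2 ≤ 2 * 2 ^ K := by
  induction K, hK using Nat.le_induction with
  | base => norm_num
  | succ K hK ih => rw [pow_succ 2 K]; nlinarith

/-- The left side is the bound on 4W(K+1) for K = 2(m+1), and 8·5^m + 18 is the least possible β.
The case m = 1 reads 46.67 ≤ 46.98 and dictates 81/100; afterwards the left side grows by at most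
49/15 < 5. -/
theorem weight_growth {m : ℕ} (hm : 1 ≤ m) :
    4 * (7 / 3 : ℝ) ^ m * (2 * m + 3) ≤ 81 / 100 * (8 * 5 ^ m + 18) := by
  induction m, hm using Nat.le_induction with
  | base => norm_num
  | succ m hm ih =>
    have hm' : (1 : ℝ) ≤ m := by exact_mod_cast hm
    have h5 : (5 : ℝ) ≤ 5 ^ m := by
      simpa using pow_le_pow_right₀ (by norm_num : (1 : ℝ) ≤ 5) hm
    have h7 : (0 : ℝ) < (7 / 3) ^ m := by positivity
    rw [pow_succ, pow_succ]
    push_cast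
    have h1 : 2 * ((m : ℝ) + 1) + 3 ≤ 7 / 5 * (2 * m + 3) := by linarith
    calc 4 * ((7 / 3 : ℝ) ^ m * (7 / 3)) * (2 * (m + 1) + 3)
        ≤ 4 * ((7 / 3 : ℝ) ^ m * (7 / 3)) * (7 / 5 * (2 * m + 3)) := by gcongr
      _ = 49 / 15 * (4 * (7 / 3 : ℝ) ^ m * (2 * m + 3)) := by ring
      _ ≤ _ := by linarith

/-- The relation between the number of stages and the total length of the stages. -/
theorem IsStageForm.cases {K : ℕ} (hK : K = 1 ∨ ∃ k : ℕ, 1 ≤ k ∧ K = 2 * k) {κ : ℕ}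
    {a b : Fin κ → ℝ} (hstage : IsStageForm K a b) {β : ℝ} (hβ : β = 2 * (4 * (κ : ℝ) + 5)) :
    (K = 1 ∧ trotterWeight K = 1 ∧ (1 : ℝ) ≤ κ ∧ 18 ≤ β) ∨
    (K = 2 ∧ trotterWeight K = 1 ∧ (2 : ℝ) ≤ κ ∧ 26 ≤ β) ∨
    (4 ≤ K ∧ (6 : ℝ) ≤ κ ∧ 58 ≤ β ∧ 1 + trotterWeight K ≤ κ ∧
      4 * trotterWeight K * (K + 1) ≤ 81 / 100 * β) := by
  rcases hK with rfl | ⟨k, hk, rfl⟩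
  · left
    have h1 : (1 : ℝ) ≤ κ := by exact_mod_cast hstage.one_le
    exact ⟨rfl, by simp [trotterWeight], h1, by linarith⟩
  · right
    obtain ⟨m, rfl⟩ := Nat.exists_eq_add_of_le' hk
    -- Hence β = 8κ + 10 ≥ 8·5^m + 18, which is 26 for m = 0 and at least 58 for m ≥ 1.
    have h1 : (5 : ℝ) ^ m + 1 ≤ κ := by exact_mod_cast hstage.five_pow_lt
    have hw : trotterWeight (2 * (m + 1)) = suzukiWeight m := by
      rw [trotterWeight, if_neg (by omega), Nat.mul_div_cancel_left _ two_pos, Nat.add_sub_cancel]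
    rcases Nat.eq_zero_or_pos m with rfl | hm
    · left
      have h2 : (2 : ℝ) ≤ κ := by norm_num at h1; exact_mod_cast h1
      exact ⟨rfl, by rw [hw]; rfl, h2, by linarith⟩
    · right
      have h5 : (5 : ℝ) ≤ 5 ^ m := by
        simpa using pow_le_pow_right₀ (by norm_num : (1 : ℝ) ≤ 5) hm
      have h6 := suzukiWeight_le m
      have h7 : (7 / 3 : ℝ) ^ m ≤ 5 ^ m := pow_le_pow_left₀ (by norm_num) (by norm_num) m
      have h8 := weight_growth hm
      refine ⟨by omega, by linarith, by linarith, by rw [hw]; linarith, ?_⟩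
      rw [hw]
      push_cast
      have h9 : 4 * suzukiWeight m * (2 * (m + 1) + 1) ≤ 4 * (7 / 3 : ℝ) ^ m * (2 * m + 3) := by
        rw [show (2 * ((m : ℝ) + 1) + 1) = 2 * m + 3 by ring]
        gcongr
      linarith

theorem factorial_mul_pow_le {K : ℕ} {w β : ℝ} (hw : 0 < w)
    (h : 4 * w * (K + 1) ≤ 81 / 100 * β) :
    K.factorial * (4 * w) ^ K ≤ (81 / 200 * β) ^ K := by
  calc K.factorial * (4 * w) ^ K ≤ ((K + 1) / 2) ^ K * (4 * w) ^ K := by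
        gcongr; exact factorial_le_half_pow K
    _ = (4 * w * (K + 1) / 2) ^ K := by rw [← mul_pow]; congr 1; ring
    _ ≤ _ := by gcongr; linarith

/-- Here σ and σ' stand for the two values of `geomTail`. After multiplication by K!(K+1)! the
powers of 4w combine with K!² into at most 6^{-K} β^{2K}, as (81/200)² < 1/6; the factor 6^{-K}
absorbs the cubic polynomial in K left by σ². -/
theorem error_constant_le {K : ℕ} (hK4 : 4 ≤ K) {w κ β σ σ' : ℝ} (hw : 0 < w) (hκ : 6 ≤ κ)
    (hβ : 58 ≤ β) (hwκ : 1 + w ≤ κ) (hwβ : 4 * w * (K + 1) ≤ 81 / 100 * β) (hσ0 : 0 ≤ σ) (hσ0' : 0 ≤ σ')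
    (hσ : σ ≤ 11 * (K + 1) * (K + 2)) (hσ' : σ' ≤ 11 * (2 * K + 2) * (2 * K + 3)) :
    (1 + w) ^ 2 * (4 * w) ^ (2 * K) * σ ^ 2 / (2 * (K + 1) ^ 2) +
      (1 + w) * (4 * w) ^ (2 * K + 1) * σ' / (2 * K + 2) ≤
      κ ^ 2 * β ^ (2 * K + 1) / (K.factorial * (K + 1).factorial) := by
  have hK' : (4 : ℝ) ≤ K := by exact_mod_cast hK4
  have hf : (0 : ℝ) < K.factorial := by positivity
  have h1 := factorial_mul_pow_le hw hwβ
  have h2 : ((K.factorial : ℝ) * (4 * w) ^ K) ^ 2 ≤ (1 / 6) ^ K * β ^ (2 * K) := by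
    calc ((K.factorial : ℝ) * (4 * w) ^ K) ^ 2 ≤ ((81 / 200 * β) ^ K) ^ 2 := by gcongr
      _ = ((81 / 200) ^ 2) ^ K * β ^ (2 * K) := by
        rw [mul_pow, mul_pow, ← pow_mul, ← pow_mul, ← pow_mul, mul_comm K 2]
      _ ≤ _ := by gcongr; norm_num
  have h6 : (7 : ℝ) * (K + 2) ^ 2 * (K + 1) * (1 / 6) ^ K ≤ 1 := by
    rw [one_div, inv_pow, ← div_eq_mul_inv, div_le_one (by positivity)]
    exact_mod_cast cubic_le_six_pow hK4
  set P := (1 / 6 : ℝ) ^ K with hP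
  have hP0 : 0 < P := by positivity
  set X := β ^ (2 * K) with hX
  have hX0 : 0 < X := by positivity
  set F := ((K.factorial : ℝ) * (4 * w) ^ K) ^ 2 with hF
  have hF0 : 0 ≤ F := by positivity
  have hFe : F = (K.factorial : ℝ) ^ 2 * (4 * w) ^ (2 * K) := by rw [hF]; ring
  rw [le_div_iff₀ (by positivity), Nat.factorial_succ]
  push_cast
  have e : ((1 + w) ^ 2 * (4 * w) ^ (2 * K) * σ ^ 2 / (2 * (K + 1) ^ 2) +
      (1 + w) * (4 * w) ^ (2 * K + 1) * σ' / (2 * K + 2)) *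
      (K.factorial * ((K + 1) * K.factorial)) =
      (1 + w) ^ 2 * (σ ^ 2 / (2 * (K + 1))) * F + (1 + w) * (4 * w) * (σ' / 2) * F := by
    rw [hFe, pow_succ (4 * w)]
    field_simp
  have hσ2 : σ ^ 2 / (2 * (K + 1)) ≤ 121 / 14 * (7 * (K + 2) ^ 2 * (K + 1)) := by
    rw [div_le_iff₀ (by positivity)]
    calc σ ^ 2 ≤ (11 * (K + 1) * (K + 2)) ^ 2 := by gcongr
      _ = _ := by ring
  have hσ3 : 4 * w * (σ' / 2) ≤ 9 * β * (2 * K + 3) := by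
    calc 4 * w * (σ' / 2) ≤ 4 * w * (11 * (2 * K + 2) * (2 * K + 3) / 2) := by gcongr
      _ = 11 * (2 * K + 3) * (4 * w * (K + 1)) := by ring
      _ ≤ 11 * (2 * K + 3) * (81 / 100 * β) := by gcongr
      _ ≤ 9 * β * (2 * K + 3) := by nlinarith
  have hκ0 : 0 < κ := by linarith
  have t1 : (1 + w) ^ 2 * (σ ^ 2 / (2 * (K + 1))) * F ≤ κ ^ 2 * (121 / 14) * X := by
    calc (1 + w) ^ 2 * (σ ^ 2 / (2 * (K + 1))) * F
        ≤ κ ^ 2 * (121 / 14 * (7 * (K + 2) ^ 2 * (K + 1))) * (P * X) := by gcongr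
      _ = κ ^ 2 * (121 / 14) * X * (7 * (K + 2) ^ 2 * (K + 1) * P) := by ring
      _ ≤ κ ^ 2 * (121 / 14) * X * 1 := by gcongr
      _ = _ := mul_one _
  have h7 : (2 * (K : ℝ) + 3) * P ≤ 1 / 7 := by
    have : (2 * (K : ℝ) + 3) ≤ (K + 2) ^ 2 * (K + 1) := by nlinarith
    have := mul_le_mul_of_nonneg_right this hP0.le
    linarith
  have t2 : (1 + w) * (4 * w) * (σ' / 2) * F ≤ κ * (9 / 7) * β * X := by
    calc (1 + w) * (4 * w) * (σ' / 2) * F = (1 + w) * (4 * w * (σ' / 2)) * F := by ring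
      _ ≤ κ * (9 * β * (2 * K + 3)) * (P * X) := by gcongr
      _ = κ * 9 * β * X * ((2 * K + 3) * P) := by ring
      _ ≤ κ * 9 * β * X * (1 / 7) := by gcongr
      _ = _ := by ring
  rw [e, pow_succ β, ← hX]
  have h8 : κ ^ 2 * (121 / 14) + κ * (9 / 7) * β ≤ κ ^ 2 * β := by
    have a1 : 0 ≤ κ * β * (κ - 6) := by
      have : 0 ≤ κ - 6 := by linarith
      positivity
    have a2 : 0 ≤ κ ^ 2 * (β - 58) := by
      have : 0 ≤ β - 58 := by linarith
      positivity
    linarith [sq_nonneg κ]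
  have := mul_le_mul_of_nonneg_right h8 hX0.le
  linarith


/-- K!(4w)^K ≤ (β/2)^K, and 2^{-K} absorbs (K+1)² up to the factor 2 ≤ β. -/
theorem sum_constant_le {K : ℕ} (hK4 : 4 ≤ K) {w κ β : ℝ} (hw : 0 < w) (hκ : 6 ≤ κ)
    (hβ : 58 ≤ β) (hwκ : 1 + w ≤ κ) (hwβ : 4 * w * (K + 1) ≤ 81 / 100 * β) :
    (1 + w) * (K + 1) ^ 2 * (4 * w) ^ K ≤ κ * β ^ (K + 1) / K.factorial := by
  have hf : (0 : ℝ) < K.factorial := by positivity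
  have h1 := factorial_mul_pow_le hw hwβ
  have h2 : ((K : ℝ) + 1) ^ 2 * (1 / 2) ^ K ≤ 2 := by
    rw [one_div, inv_pow, ← div_eq_mul_inv, div_le_iff₀ (by positivity)]
    exact_mod_cast sq_le_two_pow hK4
  rw [le_div_iff₀ hf]
  calc (1 + w) * (K + 1) ^ 2 * (4 * w) ^ K * K.factorial
      = (1 + w) * (K + 1) ^ 2 * (K.factorial * (4 * w) ^ K) := by ring
    _ ≤ κ * (K + 1) ^ 2 * (81 / 200 * β) ^ K := by gcongr
    _ ≤ κ * (K + 1) ^ 2 * (1 / 2 * β) ^ K := by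
      have : 81 / 200 * β ≤ 1 / 2 * β := by linarith
      gcongr
    _ = κ * β ^ K * ((K + 1) ^ 2 * (1 / 2) ^ K) := by rw [mul_pow]; ring
    _ ≤ κ * β ^ K * β := by gcongr; linarith
    _ = _ := by ring

/-! ### The bounds on ε_K and μ_K -/

namespace LatticeHamiltonian

variable {n N : ℕ} (h : LatticeHamiltonian n N) {K : ℕ}

theorem le_of_mul_lt {w β y K' c : ℝ} (hy : 0 ≤ y) (hK : 0 < K') (hc : 0 ≤ c)
    (hx : β * y < K') (hw : w * K' ≤ c * β) : w * y ≤ c := by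
  have h1 : w * K' * y ≤ c * β * y := mul_le_mul_of_nonneg_right hw hy
  have h2 : c * (β * y) ≤ c * K' := mul_le_mul_of_nonneg_left hx.le hc
  have h3 : w * y * K' ≤ c * K' := by linarith
  exact le_of_mul_le_mul_right h3 hK

/-- The error bound, reduced to an inequality between constants. -/
theorem eps_le_of_constant_le (hn : 0 < n) (hK : K = 1 ∨ ∃ k : ℕ, 1 ≤ k ∧ K = 2 * k) {x : ℝ}
    (hx0 : 0 ≤ x) {c κ β : ℝ} (hc : c < 1) (hθ : 4 * trotterWeight K * h.Lam * x ≤ c)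
    (hconst : (1 + trotterWeight K) ^ 2 * (4 * trotterWeight K) ^ (2 * K) * geomTail K c ^ 2 /
      (2 * (K + 1) ^ 2) +
      (1 + trotterWeight K) * (4 * trotterWeight K) ^ (2 * K + 1) * geomTail (2 * K + 1) c /
        (2 * K + 2) ≤ κ ^ 2 * β ^ (2 * K + 1) / (K.factorial * (K + 1).factorial)) :
    h.eps K x ≤ ((n : ℝ) * κ) ^ 2 *
      (β ^ (2 * K + 1) / ((K.factorial : ℝ) * ((K + 1).factorial : ℝ))) *
      (h.Lam * x) ^ (2 * K + 2) := by
  refine (h.eps_le_of_lt_one hK hx0 (hθ.trans_lt hc)).trans ?_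
  set w := trotterWeight K with hwdef
  set θ := 4 * w * h.Lam * x with hθdef
  have hw : 0 < w := trotterWeight_pos K
  have hL := h.Lam_nonneg
  have hn' : (1 : ℝ) ≤ n := by exact_mod_cast hn
  have hσ := geomTail_mono K hθ hc
  have hσ0 := geomTail_nonneg K (hθ.trans_lt hc)
  have hσ' := geomTail_mono (2 * K + 1) hθ hc
  have hσ0' := geomTail_nonneg (2 * K + 1) (hθ.trans_lt hc)
  have hσ1' := geomTail_nonneg (2 * K + 1) hc
  have hy : 0 ≤ (h.Lam * x) ^ (2 * K + 2) := by positivity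
  calc _ = (n : ℝ) ^ 2 * ((1 + w) ^ 2 * (4 * w) ^ (2 * K) * geomTail K θ ^ 2 /
        (2 * (K + 1) ^ 2)) * (h.Lam * x) ^ (2 * K + 2) +
        n * ((1 + w) * (4 * w) ^ (2 * K + 1) * geomTail (2 * K + 1) θ / (2 * K + 2)) *
          (h.Lam * x) ^ (2 * K + 2) := by
        rw [mul_pow h.Lam x]; ring
    _ ≤ (n : ℝ) ^ 2 * ((1 + w) ^ 2 * (4 * w) ^ (2 * K) * geomTail K c ^ 2 /
        (2 * (K + 1) ^ 2)) * (h.Lam * x) ^ (2 * K + 2) +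
        (n : ℝ) ^ 2 * ((1 + w) * (4 * w) ^ (2 * K + 1) * geomTail (2 * K + 1) c / (2 * K + 2)) *
          (h.Lam * x) ^ (2 * K + 2) := by
        -- The Taylor tail is only linear in n; n ≥ 1 brings it under the quadratic term.
        have : (n : ℝ) ≤ (n : ℝ) ^ 2 := by nlinarith
        gcongr
    _ = (n : ℝ) ^ 2 * (h.Lam * x) ^ (2 * K + 2) * ((1 + w) ^ 2 * (4 * w) ^ (2 * K) *
        geomTail K c ^ 2 / (2 * (K + 1) ^ 2) +
        (1 + w) * (4 * w) ^ (2 * K + 1) * geomTail (2 * K + 1) c / (2 * K + 2)) := by ring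
    _ ≤ (n : ℝ) ^ 2 * (h.Lam * x) ^ (2 * K + 2) *
        (κ ^ 2 * β ^ (2 * K + 1) / (K.factorial * (K + 1).factorial)) := by gcongr
    _ = _ := by ring

theorem eps_le (hn : 0 < n) (hK : K = 1 ∨ ∃ k : ℕ, 1 ≤ k ∧ K = 2 * k) {κ : ℕ}
    {a b : Fin κ → ℝ} (hstage : IsStageForm K a b) {β : ℝ} (hβ : β = 2 * (4 * (κ : ℝ) + 5))
    {x : ℝ} (hx : 0 < x) (hx0 : β * h.Lam * x < (K : ℝ) + 1) :
    h.eps K x ≤ ((n : ℝ) * (κ : ℝ)) ^ 2 *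
      (β ^ (2 * K + 1) / ((K.factorial : ℝ) * ((K + 1).factorial : ℝ))) *
      (h.Lam * x) ^ (2 * K + 2) := by
  have hy : 0 ≤ h.Lam * x := mul_nonneg h.Lam_nonneg hx.le
  rw [mul_assoc] at hx0
  rcases hstage.cases hK hβ with ⟨rfl, hw, hκ, hβ'⟩ | ⟨rfl, hw, hκ, hβ'⟩ |
    ⟨hK4, hκ, hβ', hwκ, hwβ⟩
  -- The ratio c bounds 4WΛx < 4W(K+1)/β: it is 8/18 for K = 1 and 12/26 for K = 2.
  · refine h.eps_le_of_constant_le hn hK hx.le (c := 4 / 9) (by norm_num) ?_ ?_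
    · rw [hw, mul_assoc]
      refine le_of_mul_lt hy (by norm_num) (by norm_num) hx0 ?_
      push_cast; linarith
    · rw [hw]
      have h1 : (1 : ℝ) * 18 ^ 3 ≤ (κ : ℝ) ^ 2 * β ^ 3 := by gcongr; nlinarith
      norm_num [geomTail, Nat.factorial] at h1 ⊢
      linarith
  · refine h.eps_le_of_constant_le hn hK hx.le (c := 6 / 13) (by norm_num) ?_ ?_
    · rw [hw, mul_assoc]
      refine le_of_mul_lt hy (by norm_num) (by norm_num) hx0 ?_
      push_cast; linarith
    · rw [hw]
      have h1 : (2 : ℝ) ^ 2 * 26 ^ 5 ≤ (κ : ℝ) ^ 2 * β ^ 5 := by gcongr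
      norm_num [geomTail, Nat.factorial] at h1 ⊢
      linarith
  · have hc : (81 / 100 : ℝ) < 1 := by norm_num
    refine h.eps_le_of_constant_le hn hK hx.le hc ?_ ?_
    · rw [mul_assoc]
      exact le_of_mul_lt hy (by positivity) (by norm_num) hx0 hwβ
    · refine error_constant_le hK4 (trotterWeight_pos K) hκ hβ' hwκ hwβ (geomTail_nonneg _ hc)
        (geomTail_nonneg _ hc) (geomTail_le K hK4 le_rfl) ?_
      have := geomTail_le (2 * K + 1) (by omega) (le_refl (81 / 100 : ℝ))
      push_cast at this
      linarith

theorem eta_nonneg (s : ℕ) {x : ℝ} (hx : 0 ≤ x) : 0 ≤ h.eta K s x :=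
  mul_nonneg (pauliNorm_nonneg _) (by positivity)

theorem etaSum_nonneg {x : ℝ} (hx : 0 ≤ x) : 0 ≤ h.etaSum K x :=
  Finset.sum_nonneg fun s _ => h.eta_nonneg s hx

/-- Only K + 1 terms are summed, so a ratio up to 1 is harmless. Each has (s + 1)/2 ≤ K + 1 left
from the factorials, whence (K+1)². -/
theorem etaSum_le_of_le_one (hK : K = 1 ∨ ∃ k : ℕ, 1 ≤ k ∧ K = 2 * k) {x : ℝ} (hx : 0 ≤ x)
    (hθ : 4 * trotterWeight K * (h.Lam1 * x) ≤ 1) :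
    h.etaSum K x ≤ n * ((1 + trotterWeight K) * (K + 1) ^ 2 * (4 * trotterWeight K) ^ K) *
      (h.Lam1 * x) ^ (K + 1) := by
  set w := trotterWeight K with hwdef
  have hw : 0 < w := trotterWeight_pos K
  have hL := h.Lam1_nonneg
  have key : ∀ s ∈ Finset.Icc (K + 1) (2 * K + 1), h.eta K s x ≤
      n * ((1 + w) * (K + 1) * (4 * w) ^ K) * (h.Lam1 * x) ^ (K + 1) := fun s hs => by
    obtain ⟨h1, h2⟩ := Finset.mem_Icc.1 hs
    obtain ⟨s, rfl⟩ := Nat.exists_eq_add_of_le h1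
    have hC := h.pauliNorm_C_le hK (K + s)
    rw [← hwdef] at hC
    have hs' : (s : ℝ) ≤ K := by exact_mod_cast (by omega : s ≤ K)
    rw [eta, show K + 1 + s - 1 = K + s by omega, show K + 1 + s = K + s + 1 by ring]
    calc pauliNorm (h.C K (K + s)) * (x ^ (K + s + 1) / (K + s + 1).factorial)
        ≤ n * (1 + w) * h.Lam1 * (4 * w * h.Lam1) ^ (K + s) * ((K + s + 2).factorial / 2) *
          (x ^ (K + s + 1) / (K + s + 1).factorial) :=
        mul_le_mul_of_nonneg_right hC (by positivity)
      _ = n * ((1 + w) * ((K + s + 2) / 2) * (4 * w) ^ K) * (h.Lam1 * x) ^ (K + 1) *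
          (4 * w * (h.Lam1 * x)) ^ s := by
        rw [Nat.factorial_succ (K + s + 1)]
        push_cast
        field_simp
        ring
      _ ≤ n * ((1 + w) * (K + 1) * (4 * w) ^ K) * (h.Lam1 * x) ^ (K + 1) * 1 := by
        gcongr
        · linarith
        · exact pow_le_one₀ (by positivity) hθ
      _ = _ := mul_one _
  refine (Finset.sum_le_card_nsmul _ _ _ key).trans (le_of_eq ?_)
  rw [Nat.card_Icc, show 2 * K + 1 + 1 - (K + 1) = K + 1 by omega, nsmul_eq_mul]
  push_cast
  ring

theorem etaSum_le (hK : K = 1 ∨ ∃ k : ℕ, 1 ≤ k ∧ K = 2 * k) {κ : ℕ}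
    {a b : Fin κ → ℝ} (hstage : IsStageForm K a b) {β : ℝ} (hβ : β = 2 * (4 * (κ : ℝ) + 5))
    {x : ℝ} (hx : 0 < x) (hx1 : β * h.Lam1 * x < (K : ℝ) + 2) :
    h.etaSum K x ≤ n * (κ * β ^ (K + 1) / K.factorial) * (h.Lam1 * x) ^ (K + 1) := by
  have hy : 0 ≤ h.Lam1 * x := mul_nonneg h.Lam1_nonneg hx.le
  rw [mul_assoc] at hx1
  suffices H : 4 * trotterWeight K * ((K : ℝ) + 2) ≤ 1 * β ∧
      (1 + trotterWeight K) * (K + 1) ^ 2 * (4 * trotterWeight K) ^ K ≤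
        κ * β ^ (K + 1) / K.factorial by
    refine (h.etaSum_le_of_le_one hK hx.le
      (le_of_mul_lt hy (by positivity) zero_le_one hx1 H.1)).trans ?_
    have := H.2
    gcongr
  rcases hstage.cases hK hβ with ⟨rfl, hw, hκ, hβ'⟩ | ⟨rfl, hw, hκ, hβ'⟩ |
    ⟨hK4, hκ, hβ', hwκ, hwβ⟩
  · rw [hw]
    refine ⟨by push_cast; linarith, ?_⟩
    have h1 : (1 : ℝ) * 18 ^ 2 ≤ κ * β ^ 2 := by gcongr
    norm_num [Nat.factorial] at h1 ⊢
    linarith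
  · rw [hw]
    refine ⟨by push_cast; linarith, ?_⟩
    have h1 : (2 : ℝ) * 26 ^ 3 ≤ κ * β ^ 3 := by gcongr
    norm_num [Nat.factorial] at h1 ⊢
    linarith
  · refine ⟨?_, sum_constant_le hK4 (trotterWeight_pos K) hκ hβ' hwκ hwβ⟩
    have hw := trotterWeight_pos K
    have hK' : (4 : ℝ) ≤ K := by exact_mod_cast hK4
    -- For K ≥ 4, (K+2)/(K+1) ≤ 6/5 and 6/5 · 81/100 < 1.
    nlinarith

theorem mu_le (hK : K = 1 ∨ ∃ k : ℕ, 1 ≤ k ∧ K = 2 * k) {κ : ℕ}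
    {a b : Fin κ → ℝ} (hstage : IsStageForm K a b) {β : ℝ} (hβ : β = 2 * (4 * (κ : ℝ) + 5))
    {x : ℝ} (hx : 0 < x) (hx1 : β * h.Lam1 * x < (K : ℝ) + 2) :
    h.mu K x ≤ Real.exp ((n : ℝ) ^ 2 * (κ : ℝ) ^ 2 * β ^ (2 * K + 2) /
      (2 * (K.factorial : ℝ) ^ 2) * (h.Lam1 * x) ^ (2 * K + 2)) := by
  have h1 := h.etaSum_le hK hstage hβ hx hx1
  have h2 := pow_le_pow_left₀ (h.etaSum_nonneg hx.le) h1 2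
  -- Square root of 1 + y ≤ e^y with y = η_Σ².
  have h3 : √(1 + h.etaSum K x ^ 2) ≤ Real.exp (h.etaSum K x ^ 2 / 2) := by
    rw [Real.sqrt_le_left (Real.exp_pos _).le, ← Real.exp_nat_mul]
    have := Real.add_one_le_exp (h.etaSum K x ^ 2)
    rw [show ((2 : ℕ) : ℝ) * (h.etaSum K x ^ 2 / 2) = h.etaSum K x ^ 2 by push_cast; ring]
    linarith
  refine h3.trans (Real.exp_le_exp.2 ?_)
  have h4 := div_le_div_of_nonneg_right h2 (zero_le_two (α := ℝ))
  refine h4.trans (le_of_eq ?_)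
  have hf : (K.factorial : ℝ) ≠ 0 := by positivity
  field_simp
  ring

end LatticeHamiltonian

/-! ### The paired formula -/

/-- The product of e^{-izP} with the right-hand side has derivative zero, because P² = 1, and equals
1 at z = 0. -/
theorem expI_neg_of_mul_self_eq_one {𝒜 : Type*} [NormedRing 𝒜] [NormedAlgebra ℂ 𝒜]
    [CompleteSpace 𝒜] {P : 𝒜} (hP : P * P = 1) (z : ℂ) :
    expI P (-z) = Complex.cos z • (1 : 𝒜) + (Complex.I * Complex.sin z) • P := by
  have hd : ∀ z : ℂ, HasDerivAt (fun z => expI P z *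
      (Complex.cos z • (1 : 𝒜) + (Complex.I * Complex.sin z) • P)) 0 z := fun z => by
    have h1 := (hasDerivAt_expI P z).mul (((Complex.hasDerivAt_cos z).smul_const (1 : 𝒜)).add
      (((Complex.hasDerivAt_sin z).const_mul Complex.I).smul_const P))
    refine h1.congr_deriv ?_
    rw [mul_assoc, ← mul_add]
    have : -Complex.I • P * (Complex.cos z • (1 : 𝒜) + (Complex.I * Complex.sin z) • P) +
        (-Complex.sin z • (1 : 𝒜) + (Complex.I * Complex.cos z) • P) = 0 := by
      rw [mul_add, smul_mul_smul_comm, smul_mul_smul_comm, mul_one, hP]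
      have e : -Complex.I * (Complex.I * Complex.sin z) = Complex.sin z := by
        linear_combination (-Complex.sin z) * Complex.I_mul_I
      rw [e]
      module
    exact (congrArg (expI P z * ·) this).trans (mul_zero _)
  have hc := is_const_of_deriv_eq_zero (fun z => (hd z).differentiableAt) (fun z => (hd z).deriv) z 0
  simp only [expI_zero, Complex.cos_zero, Complex.sin_zero, mul_zero, zero_smul, add_zero, one_smul,
    mul_one] at hc
  calc expI P (-z) = expI P (-z) * (expI P z *
        (Complex.cos z • (1 : 𝒜) + (Complex.I * Complex.sin z) • P)) := by rw [hc, mul_one]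
    _ = _ := by rw [← mul_assoc, expI_neg_mul, one_mul]

namespace LatticeHamiltonian

variable {n N : ℕ} (h : LatticeHamiltonian n N) (K : ℕ)

theorem signedPauli_mul_self (s : ℕ) (p : PauliString N) :
    h.signedPauli K s p * h.signedPauli K s p = 1 := by
  rw [signedPauli]; split_ifs <;> simp [pauliOp_mul_self]

theorem isHermitian_signedPauli (s : ℕ) (p : PauliString N) :
    (h.signedPauli K s p).IsHermitian := by
  rw [signedPauli]; split_ifs
  · exact conjTranspose_pauliOp p
  · rw [Matrix.IsHermitian, Matrix.conjTranspose_neg, conjTranspose_pauliOp]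

theorem pairedUnitary_eq (x : ℝ) (i : PairIndex N K) : h.pairedUnitary K x i =
    expI (h.signedPauli K (i.1 - 1) i.2) (((-Real.arctan (h.etaSum K x) : ℝ)) : ℂ) := by
  rw [pairedUnitary, expI]
  congr 2
  push_cast
  ring

theorem pairedUnitary_mem (x : ℝ) (i : PairIndex N K) :
    h.pairedUnitary K x i ∈ Matrix.unitaryGroup (Qubits N) ℂ := by
  rw [pairedUnitary_eq]
  exact expI_mem_unitary (h.isHermitian_signedPauli K _ _) _

/-- At θ = arctan η, cos θ = 1/√(1+η²) and sin θ = η/√(1+η²), so μ clears both denominators. -/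
theorem mu_smul_pairedUnitary (x : ℝ) (i : PairIndex N K) :
    (h.mu K x : ℂ) • h.pairedUnitary K x i =
      1 + (Complex.I * h.etaSum K x) • h.signedPauli K (i.1 - 1) i.2 := by
  have hpos : (0 : ℝ) < 1 + h.etaSum K x ^ 2 := by positivity
  have hmu : √(1 + h.etaSum K x ^ 2) ≠ 0 := (Real.sqrt_pos.2 hpos).ne'
  rw [pairedUnitary_eq, Complex.ofReal_neg,
    expI_neg_of_mul_self_eq_one (h.signedPauli_mul_self K _ _), ← Complex.ofReal_cos,
    ← Complex.ofReal_sin, Real.cos_arctan, Real.sin_arctan, smul_add, smul_smul, smul_smul, mu]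
  have e1 : ((√(1 + h.etaSum K x ^ 2) : ℝ) : ℂ) * ((1 / √(1 + h.etaSum K x ^ 2) : ℝ) : ℂ) = 1 := by
    rw [← Complex.ofReal_mul, mul_one_div_cancel hmu, Complex.ofReal_one]
  have e2 : ((√(1 + h.etaSum K x ^ 2) : ℝ) : ℂ) *
      (Complex.I * ((h.etaSum K x / √(1 + h.etaSum K x ^ 2) : ℝ) : ℂ)) =
      Complex.I * h.etaSum K x := by
    rw [mul_left_comm, ← Complex.ofReal_mul, mul_div_cancel₀ _ hmu]
  rw [e1, e2, one_smul]

theorem abs_coeffC (s : ℕ) (p : PauliString N) :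
    |h.coeffC K s p| = ‖pauliCoeff (h.C K s) p‖ := by
  rw [pauliCoeff_of_skew (h.conjTranspose_C K s) p, norm_mul, Complex.norm_I, one_mul,
    Complex.norm_real, Real.norm_eq_abs, coeffC]

/-- The Pauli expansion of `C_s`. -/
theorem sum_probC_smul (s : ℕ) : (Complex.I * pauliNorm (h.C K s)) •
    ∑ p, (h.probC K s p : ℂ) • h.signedPauli K s p = h.C K s := by
  by_cases h0 : pauliNorm (h.C K s) = 0
  · rw [h0, eq_zero_of_pauliNorm_eq_zero h0]; simp
  · have h0' : (pauliNorm (h.C K s) : ℂ) ≠ 0 := by exact_mod_cast h0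
    conv_rhs => rw [← sum_pauliCoeff_smul (h.C K s)]
    rw [Finset.smul_sum]
    refine Finset.sum_congr rfl fun p _ => ?_
    rw [pauliCoeff_of_skew (h.conjTranspose_C K s) p, smul_smul, probC, signedPauli,
      Complex.ofReal_div, mul_assoc, mul_div_cancel₀ _ h0']
    change _ = (Complex.I * (h.coeffC K s p : ℂ)) • pauliOp p
    split_ifs with hc
    · rw [abs_of_nonneg hc]
    · rw [abs_of_neg (not_le.1 hc)]; simp

theorem sum_probC {s : ℕ} (h0 : pauliNorm (h.C K s) ≠ 0) : ∑ p, h.probC K s p = 1 := by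
  simp only [probC, abs_coeffC, ← Finset.sum_div]
  exact div_self h0

/-- If C_{s-1} = 0, the quotients defining the probabilities are 0 and do not sum to 1, but then η_s
= 0 as well. -/
theorem eta_mul_sum_probC (s : ℕ) (x : ℝ) :
    h.eta K s x * ∑ p, h.probC K (s - 1) p = h.eta K s x := by
  by_cases h0 : pauliNorm (h.C K (s - 1)) = 0
  · simp [eta, h0]
  · rw [h.sum_probC K h0, mul_one]

theorem eta_smul_sum (s : ℕ) (x : ℝ) : (Complex.I * h.eta K s x) •
    ∑ p, (h.probC K (s - 1) p : ℂ) • h.signedPauli K (s - 1) p = h.F K s x := by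
  rw [F]
  conv_rhs => rw [← h.sum_probC_smul K (s - 1)]
  rw [smul_smul, eta]
  congr 1
  push_cast
  ring

theorem pairedProb_nonneg {x : ℝ} (hx : 0 ≤ x) (i : PairIndex N K) : 0 ≤ h.pairedProb K x i := by
  rw [pairedProb]; split_ifs
  · positivity
  · exact mul_nonneg (div_nonneg (h.eta_nonneg _ hx) (h.etaSum_nonneg hx))
      (div_nonneg (abs_nonneg _) (pauliNorm_nonneg _))

theorem sum_pairIndex {M : Type*} [AddCommMonoid M] (f : ℕ → PauliString N → M) :
    ∑ i : PairIndex N K, f i.1 i.2 = ∑ s ∈ Finset.Icc (K + 1) (2 * K + 1), ∑ p, f s p := by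
  rw [Fintype.sum_prod_type, ← Finset.sum_coe_sort (Finset.Icc (K + 1) (2 * K + 1))]

theorem pairedProb_sum (x : ℝ) : ∑ i, h.pairedProb K x i = 1 := by
  by_cases h0 : h.etaSum K x = 0
  · have : Nonempty (PairIndex N K) := ⟨⟨⟨K + 1, by simp; omega⟩, fun _ => 0⟩⟩
    simp only [pairedProb, if_pos h0, Finset.sum_const, nsmul_eq_mul, Finset.card_univ]
    exact mul_one_div_cancel (by exact_mod_cast Fintype.card_ne_zero)
  · simp only [pairedProb, if_neg h0]
    rw [sum_pairIndex K fun s p => h.eta K s x / h.etaSum K x * h.probC K (s - 1) p]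
    simp only [div_mul_eq_mul_div, ← Finset.sum_div, ← Finset.mul_sum, eta_mul_sum_probC]
    exact div_self h0

theorem etaSum_smul_sum {x : ℝ} (hx : 0 ≤ x) : ∑ i, (h.pairedProb K x i : ℂ) •
    ((Complex.I * h.etaSum K x) • h.signedPauli K (i.1 - 1) i.2) =
      ∑ s ∈ Finset.Icc (K + 1) (2 * K + 1), h.F K s x := by
  by_cases h0 : h.etaSum K x = 0
  -- For x ≥ 0 the η_s are nonnegative, so η_Σ = 0 makes every F_s vanish.
  · have h1 := (Finset.sum_eq_zero_iff_of_nonneg fun s _ => h.eta_nonneg s hx).1 h0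
    simp only [h0, Complex.ofReal_zero, mul_zero, zero_smul, smul_zero, Finset.sum_const_zero]
    refine (Finset.sum_eq_zero fun s hs => ?_).symm
    rw [← eta_smul_sum, h1 s hs]; simp
  · have h0' : (h.etaSum K x : ℂ) ≠ 0 := by exact_mod_cast h0
    simp only [pairedProb, if_neg h0]
    rw [sum_pairIndex K fun s p => ((h.eta K s x / h.etaSum K x * h.probC K (s - 1) p : ℝ) : ℂ) •
      ((Complex.I * h.etaSum K x) • h.signedPauli K (s - 1) p)]
    refine Finset.sum_congr rfl fun s _ => ?_
    rw [← eta_smul_sum, Finset.smul_sum]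
    refine Finset.sum_congr rfl fun p _ => ?_
    rw [smul_smul, smul_smul]
    congr 1
    push_cast
    field_simp

theorem mu_smul_sum {x : ℝ} (hx : 0 ≤ x) :
    (h.mu K x : ℂ) • ∑ i, (h.pairedProb K x i : ℂ) • h.pairedUnitary K x i = h.Vtilde K x := by
  rw [Finset.smul_sum, Vtilde, ← etaSum_smul_sum h K hx]
  have e : ∀ i, (h.mu K x : ℂ) • (h.pairedProb K x i : ℂ) • h.pairedUnitary K x i =
      (h.pairedProb K x i : ℂ) • (1 : Op N) + (h.pairedProb K x i : ℂ) •
        ((Complex.I * h.etaSum K x) • h.signedPauli K (i.1 - 1) i.2) := fun i => by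
    rw [smul_comm, mu_smul_pairedUnitary, smul_add]
  simp only [e, Finset.sum_add_distrib]
  rw [← Finset.sum_smul, ← Complex.ofReal_sum, pairedProb_sum, Complex.ofReal_one, one_smul]

theorem mu_pos (x : ℝ) : 0 < h.mu K x := Real.sqrt_pos.2 (by positivity)

theorem isLCUFormula_V {x : ℝ} (hx : 0 ≤ x) : IsLCUFormula (h.mu K x) (h.eps K x)
    (h.pairedProb K x) (h.pairedUnitary K x) (h.V K x) where
  mu_pos := h.mu_pos K x
  prob_nonneg := h.pairedProb_nonneg K hx
  prob_sum := h.pairedProb_sum K x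
  unitary := h.pairedUnitary_mem K x
  dist_le := by rw [mu_smul_sum h K hx, norm_sub_rev, eps]

theorem V_mul_S (x : ℝ) : h.V K x * h.S K x = h.U x := by
  rw [V, mul_assoc, conjTranspose_S, S_eq, layersInv_mul_layers, mul_one]

theorem isLCUFormula_U {x : ℝ} (hx : 0 ≤ x) : IsLCUFormula (h.mu K x) (h.eps K x)
    (h.pairedProb K x) (fun i => h.pairedUnitary K x i * h.S K x) (h.U x) where
  mu_pos := h.mu_pos K x
  prob_nonneg := h.pairedProb_nonneg K hx
  prob_sum := h.pairedProb_sum K x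
  unitary i := mul_mem (h.pairedUnitary_mem K x i) (h.S_mem_unitary K x)
  dist_le := by
    have e : (h.mu K x : ℂ) • ∑ i, (h.pairedProb K x i : ℂ) • (h.pairedUnitary K x i * h.S K x) =
        h.Vtilde K x * h.S K x := by
      rw [← mu_smul_sum h K hx, smul_mul_assoc, Finset.sum_mul]
      simp only [smul_mul_assoc]
    rw [e, ← V_mul_S h K, ← sub_mul]
    refine (norm_mul_le _ _).trans ?_
    rw [eps, norm_sub_rev]
    exact mul_le_of_le_one_right (norm_nonneg _) (norm_le_one_of_mem_unitary (h.S_mem_unitary K x))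

end LatticeHamiltonian

end TrotterLCU

end

/-- The conditions on x are multiplied out, so that they hold for every x > 0 when all the terms
vanish. -/
theorem mainTheorem3 (n N : ℕ) (hn : 0 < n) (h : TrotterLCU.LatticeHamiltonian n N)
    (K : ℕ) (hK : K = 1 ∨ ∃ k : ℕ, 1 ≤ k ∧ K = 2 * k)
    (κ : ℕ) (a b : Fin κ → ℝ) (hstage : TrotterLCU.IsStageForm K a b)
    (β : ℝ) (hβ : β = 2 * (4 * (κ : ℝ) + 5))
    (x : ℝ) (hx : 0 < x)
    (hx0 : β * h.Lam * x < (K : ℝ) + 1) (hx1 : β * h.Lam1 * x < (K : ℝ) + 2) :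
    ((h.mu K x : ℂ) • ∑ i, (h.pairedProb K x i : ℂ) • h.pairedUnitary K x i = h.Vtilde K x) ∧
    TrotterLCU.IsLCUFormula (h.mu K x) (h.eps K x)
      (h.pairedProb K x) (h.pairedUnitary K x) (h.V K x) ∧
    TrotterLCU.IsLCUFormula (h.mu K x) (h.eps K x)
      (h.pairedProb K x) (fun i => h.pairedUnitary K x i * h.S K x) (h.U x) ∧
    h.mu K x ≤ Real.exp ((n : ℝ) ^ 2 * (κ : ℝ) ^ 2 * β ^ (2 * K + 2) /
      (2 * (K.factorial : ℝ) ^ 2) * (h.Lam1 * x) ^ (2 * K + 2)) ∧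
    h.eps K x ≤ ((n : ℝ) * (κ : ℝ)) ^ 2 *
      (β ^ (2 * K + 1) / ((K.factorial : ℝ) * ((K + 1).factorial : ℝ))) *
      (h.Lam * x) ^ (2 * K + 2) :=
  ⟨h.mu_smul_sum K hx.le, h.isLCUFormula_V K hx.le, h.isLCUFormula_U K hx.le,
    h.mu_le hK hstage hβ hx hx1, h.eps_le hn hK hstage hβ hx hx0⟩
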